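/- Let $n\ge 1$ and let $A\colon[0,\infty)\to[0,\infty)$ be an arbitrary Young function, that is, $A(t)=\int_0^t a(\tau)\,d\tau$ where $a\colon[0,\infty)\to[0,\infty)$ is nondecreasing and right continuous, $a(0)=0$, $a(t)>0$ for $t>0$, and $a(t)\to\infty$ as $t\to\infty$ (no $\Delta_2$ condition is imposed on $A$ or on its conjugate). Let $$E^A(\mathbb R^n)=\Big\{u\in L^1_{\mathrm{loc}}(\mathbb R^n)\colon \int_{\mathbb R^n}A\Big(\frac{|u|}{k}\Big)\,dx<\infty\ \text{ for all } k>0\Big\},$$ with the Luxemburg norm $\|u\|_A=\inf\{k>0\colon \int_{\mathbb R^n} A(|u|/k)\,dx\le 1\}$. For $s\in(0,1)$ and $u\in E^A(\mathbb R^n)$ put $$\mathcal J_s(u)=(1-s)\iint_{\mathbb R^n\times\mathbb R^n}A\Big(\frac{|u(x)-u(y)|}{|x-y|^s}\Big)\frac{dx\,dy}{|x-y|^n}\in[0,\infty].$$ Put $$A_0(t)=\int_0^t\int_{\mathbb S^{n-1}}A(r|\omega\cdot e|)\,d\mathcal H^{n-1}(\omega)\,\frac{dr}{r},\qquad t\ge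 0,$$ where $e\in\mathbb S^{n-1}$ is any fixed unit vector and $\mathcal H^{n-1}$ is surface measure on the sphere (counting measure if $n=1$). Finally put $$\mathcal J(u)=\int_{\mathbb R^n}A_0(|\nabla u|)\,dx\in[0,\infty]$$ if $u$ has a weak gradient $\nabla u\in L^1_{\mathrm{loc}}(\mathbb R^n;\mathbb R^n)$, and $\mathcal J(u)=+\infty$ otherwise. Theorem. Let $u\in E^A(\mathbb R^n)$ and $\{u_k\}_{k\in\mathbb N}\subset E^A(\mathbb R^n)$ be such that $\|u_k-u\|_A\to 0$ as $k\to\infty$, and let $\{s_k\}_{k\in\mathbb N}\subset(0,1)$ be such that $s_k\to 1$ as $k\to\infty$. Then $$\mathcal J(u)\le\liminf_{k\to\infty}\mathcal J_{s_k}(u_k).$$ -/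

import Mathlib

open MeasureTheory Set Filter Topology
open scoped ENNReal

namespace FracOrlicz

/-- `A` (used only on `[0, ∞)`) is a Young function: `A t = ∫₀ᵗ a` for some nondecreasing,
right-continuous `a : [0, ∞) → [0, ∞)` with `a 0 = 0`, `a t > 0` for `t > 0` and
`a t → ∞` as `t → ∞`. No growth (doubling) condition is imposed. -/
def IsYoungFunction (A : ℝ → ℝ) : Prop :=
  ∃ a : ℝ → ℝ,
    MonotoneOn a (Ici 0) ∧
    (∀ t, 0 ≤ t → ContinuousWithinAt a (Ici t) t) ∧
    a 0 = 0 ∧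
    (∀ t, 0 < t → 0 < a t) ∧
    Tendsto a atTop atTop ∧
    ∀ t, 0 ≤ t → A t = ∫ τ in (0 : ℝ)..t, a τ

/-- The modular `∫ A(|u| / k) dx`, with values in `[0, ∞]`. -/
noncomputable def modular {n : ℕ} (A : ℝ → ℝ) (k : ℝ) (u : EuclideanSpace ℝ (Fin n) → ℝ) :
    ℝ≥0∞ :=
  ∫⁻ x, ENNReal.ofReal (A (|u x| / k))

/-- `u ∈ E^A(ℝⁿ)`: `u` is locally integrable and `∫ A(|u| / k) dx < ∞` for all `k > 0`. -/
def MemEA {n : ℕ} (A : ℝ → ℝ) (u : EuclideanSpace ℝ (Fin n) → ℝ) : Prop :=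
  LocallyIntegrable u ∧ ∀ k : ℝ, 0 < k → modular A k u < ⊤

/-- The Luxemburg norm `inf {k > 0 : ∫ A(|u| / k) dx ≤ 1}`. The set is nonempty for every `u`
in the Orlicz space, in particular for `u ∈ E^A(ℝⁿ)`. -/
noncomputable def luxemburgNorm {n : ℕ} (A : ℝ → ℝ) (u : EuclideanSpace ℝ (Fin n) → ℝ) : ℝ :=
  sInf {k : ℝ | 0 < k ∧ modular A k u ≤ 1}

/-- The fractional energy
`J_s(u) = (1 - s) ∬ A(|u(x) - u(y)| / |x - y|^s) |x - y|^{-n} dx dy`, with values in `[0, ∞]`. -/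
noncomputable def fracEnergy {n : ℕ} (A : ℝ → ℝ) (s : ℝ) (u : EuclideanSpace ℝ (Fin n) → ℝ) :
    ℝ≥0∞ :=
  ENNReal.ofReal (1 - s) *
    ∫⁻ p : EuclideanSpace ℝ (Fin n) × EuclideanSpace ℝ (Fin n),
      ENNReal.ofReal (A (|u p.1 - u p.2| / ‖p.1 - p.2‖ ^ s) / ‖p.1 - p.2‖ ^ n)

/-- `A₀(t) = ∫₀ᵗ ∫_{S^{n-1}} A(r |ω · e|) dH^{n-1}(ω) dr / r`, where `e` is a fixed unit vector.
The surface measure is `volume.toSphere`, i.e. `H^{n-1}` with its usual normalization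
(Mathlib's Hausdorff measure `μH[n-1]` is normalized differently). -/
noncomputable def sphericalAverage {n : ℕ} (A : ℝ → ℝ) (e : EuclideanSpace ℝ (Fin n)) (t : ℝ) :
    ℝ≥0∞ :=
  ∫⁻ r in Ioo (0 : ℝ) t,
    (∫⁻ w : Metric.sphere (0 : EuclideanSpace ℝ (Fin n)) 1,
      ENNReal.ofReal (A (r * |inner ℝ (w : EuclideanSpace ℝ (Fin n)) e|)) ∂volume.toSphere)
      / ENNReal.ofReal r

/-- `g ∈ L¹_loc(ℝⁿ; ℝⁿ)` is the weak (distributional) gradient of `u ∈ L¹_loc(ℝⁿ)`. -/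
def IsWeakGradient {n : ℕ} (u : EuclideanSpace ℝ (Fin n) → ℝ)
    (g : EuclideanSpace ℝ (Fin n) → EuclideanSpace ℝ (Fin n)) : Prop :=
  LocallyIntegrable u ∧ LocallyIntegrable g ∧
    ∀ φ : EuclideanSpace ℝ (Fin n) → ℝ, ContDiff ℝ (⊤ : ℕ∞) φ → HasCompactSupport φ →
      ∀ i : Fin n,
        ∫ x, u x * fderiv ℝ φ x (EuclideanSpace.single i 1) = -∫ x, g x i * φ x

/-- The limit energy `J(u) = ∫ A₀(|∇u|) dx`, where `∇u` is the weak gradient of `u`, and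
`J(u) = ∞` if `u` has no locally integrable weak gradient. Weak gradients are unique up to null
sets, so the infimum is over at most one value; over the empty family it is `⊤`. -/
noncomputable def limitEnergy {n : ℕ} (A : ℝ → ℝ) (e : EuclideanSpace ℝ (Fin n))
    (u : EuclideanSpace ℝ (Fin n) → ℝ) : ℝ≥0∞ :=
  ⨅ (g : EuclideanSpace ℝ (Fin n) → EuclideanSpace ℝ (Fin n)) (_ : IsWeakGradient u g),
    ∫⁻ x, sphericalAverage A e ‖g x‖

end FracOrlicz

/-! Smooth the functions, pass to the limit in the energies, then remove the smoothing. By Jensen's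
inequality and translation invariance, convolution with a probability density does not increase the
fractional energy (`fracEnergy_convolution_le`). In polar coordinates the substitution r =
t^(1/(1-s)) turns the factor 1 - s and the singular radial weight into dt/t, with difference
quotients taken at step t^(1/(1-s)); part of the domain becomes t in (0,1)
(`lintegral_polar_le_fracEnergy`). For fixed t this step tends to 0 as s → 1. After convolution with
a fixed kernel, convergence of u_k to u in L¹ on balls already gives pointwise convergence of these
quotients to directional derivatives, so Fatou's lemma bounds the limit energy of ρ ⋆ u by the
liminf L, for every kernel ρ (`lintegral_gradDensity_le_liminf`).

Since the density is superlinear, these uniform bounds yield compactness of the smoothed gradients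
(`exists_seq_tendsto_of_midpoint`). Kernels of a given radius form a midpoint-convex set, so almost
minimisers of a strictly convex functional over shrinking radii are Cauchy in L¹ of a finite
weighted measure. The limit is a weak gradient of u, and Fatou's lemma along an a.e. convergent
subsequence bounds its energy by L (`exists_isWeakGradient`). Only convexity and superlinearity are
used, so no doubling condition enters. -/

namespace FracOrlicz

/-! ### Even extension of a Young function -/

/-- The properties of the even extension of a Young function that the proof uses. -/
structure IsEvenYoung (B : ℝ → ℝ) : Prop where
  abs_eq : ∀ t, B |t| = B t
  nonneg : ∀ t, 0 ≤ B t
  zero : B 0 = 0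
  mono : MonotoneOn B (Ici 0)
  convex : ConvexOn ℝ univ B
  superlinear : ∀ K : ℝ, 0 ≤ K → ∃ C : ℝ, 0 ≤ C ∧ ∀ t, K * |t| ≤ B t + C

theorem IsEvenYoung.continuous {B : ℝ → ℝ} (hB : IsEvenYoung B) : Continuous B := by
  have := hB.convex.continuousOn isOpen_univ
  rwa [continuousOn_univ] at this

/-- Everything follows from the supporting lines A(x) + a(x)(y - x) ≤ A(y). Superlinearity uses the
line at a point where the slope exceeds K. -/
theorem IsYoungFunction.isEvenYoung {A : ℝ → ℝ} (hA : IsYoungFunction A) :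
    IsEvenYoung (fun t => A |t|) := by
  obtain ⟨a, mono, -, a0, apos, atop, hA⟩ := hA
  have a_nonneg : ∀ t, 0 ≤ t → 0 ≤ a t := fun t ht => by
    rw [← a0]; exact mono self_mem_Ici ht ht
  have hint : ∀ x y, 0 ≤ x → 0 ≤ y → IntervalIntegrable a volume x y := fun x y hx hy =>
    (mono.mono (fun z hz => (le_min hx hy).trans hz.1)).intervalIntegrable
  have support : ∀ x y, 0 ≤ x → 0 ≤ y → A x + a x * (y - x) ≤ A y := by
    intro x y hx hy
    have h : A y = A x + ∫ τ in x..y, a τ := by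
      rw [hA x hx, hA y hy, intervalIntegral.integral_add_adjacent_intervals
        (hint _ _ le_rfl hx) (hint _ _ hx hy)]
    rw [h]
    gcongr
    rcases le_total x y with hxy | hxy
    · have := intervalIntegral.integral_mono_on hxy
        (intervalIntegrable_const (c := a x)) (hint _ _ hx hy)
        (fun z hz => mono hx (hx.trans hz.1) hz.1)
      simpa [mul_comm] using this
    · have := intervalIntegral.integral_mono_on hxy (hint _ _ hy hx)
        (intervalIntegrable_const (c := a x))
        (fun z hz => mono (hy.trans hz.1) hx hz.2)
      rw [intervalIntegral.integral_symm]
      simp only [intervalIntegral.integral_const, smul_eq_mul] at this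
      linarith
  have A0 : A 0 = 0 := by rw [hA 0 le_rfl]; simp
  have A_mono : MonotoneOn A (Ici 0) := fun x hx y hy hxy => by
    have := support x y hx hy
    nlinarith [a_nonneg x hx]
  have A_nonneg : ∀ t, 0 ≤ t → 0 ≤ A t := fun t ht => by
    rw [← A0]; exact A_mono self_mem_Ici ht ht
  refine ⟨fun t => by simp, fun t => A_nonneg _ (abs_nonneg t), by simpa using A0, ?_, ?_, ?_⟩
  · intro x hx y hy hxy
    simpa [abs_of_nonneg (show 0 ≤ x from hx), abs_of_nonneg (show 0 ≤ y from hy)]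
      using A_mono hx hy hxy
  · refine ⟨convex_univ, fun x _ y _ p q hp hq hpq => ?_⟩
    have h1 : A |p • x + q • y| ≤ A (p * |x| + q * |y|) := by
      apply A_mono (mem_Ici.2 (abs_nonneg _))
      · exact add_nonneg (mul_nonneg hp (abs_nonneg _)) (mul_nonneg hq (abs_nonneg _))
      · refine (abs_add_le _ _).trans ?_
        simp [abs_mul, abs_of_nonneg hp, abs_of_nonneg hq]
    refine h1.trans ?_
    set z := p * |x| + q * |y| with hz
    have hz0 : 0 ≤ z := add_nonneg (mul_nonneg hp (abs_nonneg _)) (mul_nonneg hq (abs_nonneg _))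
    have hx := mul_le_mul_of_nonneg_left (support z |x| hz0 (abs_nonneg _)) hp
    have hy := mul_le_mul_of_nonneg_left (support z |y| hz0 (abs_nonneg _)) hq
    have hsum : p * (A z + a z * (|x| - z)) + q * (A z + a z * (|y| - z)) = A z := by
      have : p * (A z + a z * (|x| - z)) + q * (A z + a z * (|y| - z))
        = (p + q) * A z + a z * ((p * |x| + q * |y|) - (p + q) * z) := by ring
      rw [this, hpq, ← hz]; ring
    simp only [smul_eq_mul]
    linarith
  · intro K hK
    obtain ⟨t₀, h1, h2⟩ := ((atop.eventually_ge_atTop K).and (eventually_ge_atTop 0)).exists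
    refine ⟨a t₀ * t₀, mul_nonneg (a_nonneg _ h2) h2, fun t => ?_⟩
    have := support t₀ |t| h2 (abs_nonneg t)
    have h3 := A_nonneg t₀ h2
    have h4 := mul_le_mul_of_nonneg_right h1 (abs_nonneg t)
    nlinarith

/-! ### The limit density as an integral over the sphere -/

section Spherical

open scoped Pointwise

variable {n : ℕ}

local notation "E" => EuclideanSpace ℝ (Fin n)

/-- The action of a linear isometry on the unit sphere. -/
noncomputable def sphereMap (f : E ≃ₗᵢ[ℝ] E) (w : Metric.sphere (0 : E) 1) : Metric.sphere (0 : E) 1 :=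
  ⟨f w, by simp⟩

theorem continuous_sphereMap (f : E ≃ₗᵢ[ℝ] E) : Continuous (sphereMap f) := by
  unfold sphereMap; fun_prop

/-- The surface measure is a multiple of the volume of the cone over a set, and isometries preserve
volume and carry cones to cones. -/
theorem measurePreserving_sphereMap (f : E ≃ₗᵢ[ℝ] E) :
    MeasurePreserving (sphereMap f) (volume : Measure E).toSphere
      (volume : Measure E).toSphere := by
  refine ⟨(continuous_sphereMap f).measurable, ?_⟩
  ext s hs
  rw [Measure.map_apply (continuous_sphereMap f).measurable hs, Measure.toSphere_apply' _ hs,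
    Measure.toSphere_apply' _ ((continuous_sphereMap f).measurable hs)]
  congr 1
  rw [← f.measurePreserving.measure_preimage_emb f.toHomeomorph.measurableEmbedding
    (Ioo (0 : ℝ) 1 • ((↑) '' s : Set E))]
  congr 1
  ext x
  simp only [Set.mem_smul, mem_image, mem_preimage]
  constructor
  · rintro ⟨r, hr, _, ⟨w, hw, rfl⟩, rfl⟩
    exact ⟨r, hr, _, ⟨_, hw, rfl⟩, by simp [sphereMap]⟩
  · rintro ⟨r, hr, _, ⟨w, hw, rfl⟩, h⟩
    refine ⟨r, hr, _, ⟨sphereMap f.symm w, ?_, rfl⟩, ?_⟩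
    · have : sphereMap f (sphereMap f.symm w) = w := Subtype.ext (by simp [sphereMap])
      rwa [this]
    · apply f.injective
      rw [← h]
      simp [sphereMap]

/-- The reflection exchanging ‖g‖e and g moves the integrand from one direction to the other. -/
theorem lintegral_sphere_inner (f : ℝ → ℝ≥0∞) (hf : Measurable f) {e : E} (he : ‖e‖ = 1) (g : E) :
    ∫⁻ w : Metric.sphere (0 : E) 1, f (inner ℝ (w : E) g) ∂volume.toSphere =
      ∫⁻ w : Metric.sphere (0 : E) 1, f (‖g‖ * inner ℝ (w : E) e) ∂volume.toSphere := by
  set v : E := ‖g‖ • e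
  have hv : ‖v‖ = ‖g‖ := by simp [v, norm_smul, he]
  set R := (ℝ ∙ (v - g))ᗮ.reflection
  have hR : R v = g := Submodule.reflection_sub hv
  have hm : Measurable fun w : Metric.sphere (0 : E) 1 => f (inner ℝ (w : E) g) := by
    apply hf.comp; exact Continuous.measurable (by fun_prop)
  rw [← (measurePreserving_sphereMap R).lintegral_comp hm]
  refine lintegral_congr fun w => ?_
  congr 1
  have : inner ℝ (R (w : E)) (R v) = inner ℝ (w : E) v := R.inner_map_map _ _
  rw [hR] at this
  simp only [sphereMap, this, v, inner_smul_right]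

/-- The density `g ↦ A₀(|g|)` as an integral over the unit ball in polar coordinates. -/
noncomputable def gradDensity (B : ℝ → ℝ) (g : E) : ℝ≥0∞ :=
  ∫⁻ w : Metric.sphere (0 : E) 1, (∫⁻ t in Ioo (0 : ℝ) 1,
    ENNReal.ofReal (B (t * inner ℝ (w : E) g)) / ENNReal.ofReal t) ∂volume.toSphere

theorem lintegral_Ioo_scale (F : ℝ → ℝ≥0∞) {t : ℝ} (ht : 0 < t) :
    ∫⁻ r in Ioo 0 t, F r / ENNReal.ofReal r =
      ∫⁻ r in Ioo (0 : ℝ) 1, F (t * r) / ENNReal.ofReal r := by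
  have himg : (fun r => t * r) '' Ioo (0 : ℝ) 1 = Ioo 0 t := by
    rw [Set.image_mul_left_Ioo ht]; simp
  rw [← himg, lintegral_image_eq_lintegral_abs_deriv_mul measurableSet_Ioo
    (f' := fun _ => t) (fun x _ => by simpa using ((hasDerivAt_id x).const_mul t).hasDerivWithinAt)
    (fun x _ y _ h => by simpa [ht.ne'] using h)]
  refine setLIntegral_congr_fun measurableSet_Ioo fun r hr => ?_
  rw [abs_of_pos ht, ENNReal.ofReal_mul ht.le, ← mul_div_assoc]
  exact ENNReal.mul_div_mul_left _ _ (by simpa using ht) (by simp)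

theorem sphericalAverage_eq_gradDensity {B : ℝ → ℝ} (hB : IsEvenYoung B) {e : E} (he : ‖e‖ = 1)
    (g : E) : sphericalAverage B e ‖g‖ = gradDensity B g := by
  have hBm2 : Measurable fun p : ℝ × ℝ => ENNReal.ofReal (B (p.2 * p.1)) / ENNReal.ofReal p.2 := by
    have := hB.continuous; fun_prop
  rw [gradDensity, lintegral_sphere_inner (fun x => ∫⁻ t in Ioo (0 : ℝ) 1,
    ENNReal.ofReal (B (t * x)) / ENNReal.ofReal t) hBm2.lintegral_prod_right' he, sphericalAverage]
  rcases (norm_nonneg g).eq_or_lt with h0 | hpos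
  · simp [← h0, hB.zero]
  · rw [lintegral_Ioo_scale _ hpos, lintegral_lintegral_swap]
    · refine setLIntegral_congr_fun measurableSet_Ioo fun r hr => ?_
      have hr0 : 0 < r := hr.1
      simp only [div_eq_mul_inv]
      rw [← lintegral_mul_const']
      · refine lintegral_congr fun w => ?_
        rw [← hB.abs_eq (r * _), abs_mul, abs_mul, abs_of_pos hr0, abs_norm, ← mul_assoc,
          mul_comm r]
      · simp [hr0]
    · refine Measurable.aemeasurable ?_
      have := hB.continuous
      simp only [Function.uncurry_def]
      have h1 : Measurable fun p : Metric.sphere (0 : E) 1 × ℝ => p.2 * (‖g‖ * inner ℝ (p.1 : E) e) :=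
        Continuous.measurable (by fun_prop)
      exact ((this.measurable.comp h1).ennreal_ofReal).div (by fun_prop)

theorem lintegral_le_liminf {α : Type*} [MeasurableSpace α] {μ : Measure α}
    {f : ℕ → α → ℝ≥0∞} {f₀ : α → ℝ≥0∞} (hf : ∀ j, Measurable (f j))
    (h : ∀ᵐ x ∂μ, f₀ x ≤ liminf (fun j => f j x) atTop) :
    ∫⁻ x, f₀ x ∂μ ≤ liminf (fun j => ∫⁻ x, f j x ∂μ) atTop :=
  (lintegral_mono_ae h).trans (lintegral_liminf_le hf)

theorem IsEvenYoung.measurable_polar {B : ℝ → ℝ} (hB : IsEvenYoung B) :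
    Measurable fun p : (E × Metric.sphere (0 : E) 1) × ℝ =>
      ENNReal.ofReal (B (p.2 * inner ℝ (p.1.2 : E) p.1.1)) / ENNReal.ofReal p.2 := by
  have h1 : Measurable fun p : (E × Metric.sphere (0 : E) 1) × ℝ =>
      p.2 * inner ℝ (p.1.2 : E) p.1.1 := Continuous.measurable (by fun_prop)
  exact ((hB.continuous.measurable.comp h1).ennreal_ofReal).div (by fun_prop)

/-- Lower semicontinuity: the integrand converges pointwise because `B` is continuous, and Fatou's
lemma is applied on the sphere and in t. -/
theorem gradDensity_le_liminf {B : ℝ → ℝ} (hB : IsEvenYoung B) {g : ℕ → E} {g₀ : E}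
    (h : Tendsto g atTop (𝓝 g₀)) :
    gradDensity B g₀ ≤ liminf (fun j => gradDensity B (g j)) atTop := by
  have hm := hB.measurable_polar (n := n)
  refine lintegral_le_liminf (fun j => ?_) (ae_of_all _ fun w => ?_)
  · have h1 := hm.lintegral_prod_right' (ν := volume.restrict (Ioo 0 1))
    exact h1.comp (f := fun w : Metric.sphere (0 : E) 1 => (g j, w)) (by fun_prop)
  · refine lintegral_le_liminf (fun j => ?_) ?_
    · exact hm.comp (f := fun t : ℝ => ((g j, w), t)) (by fun_prop)
    · filter_upwards [ae_restrict_mem measurableSet_Ioo] with t ht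
      refine le_of_eq (Tendsto.liminf_eq ?_).symm
      refine ENNReal.Tendsto.div_const ?_ (Or.inr (by simpa using ht.1))
      refine (ENNReal.continuous_ofReal.comp hB.continuous).continuousAt.tendsto.comp ?_
      exact (tendsto_const_nhds.inner h).const_mul t

theorem measurable_gradDensity {B : ℝ → ℝ} (hB : IsEvenYoung B) :
    Measurable (gradDensity B : E → ℝ≥0∞) :=
  (hB.measurable_polar (n := n)).lintegral_prod_right'.lintegral_prod_right'

theorem lintegral_sphere_abs_inner_ne_zero {e : E} (he : ‖e‖ = 1) :
    ∫⁻ w : Metric.sphere (0 : E) 1, ENNReal.ofReal |inner ℝ (w : E) e| ∂volume.toSphere ≠ 0 := by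
  have hc : Continuous fun w : Metric.sphere (0 : E) 1 => ENNReal.ofReal |inner ℝ (w : E) e| :=
    ENNReal.continuous_ofReal.comp (by fun_prop)
  intro h
  rw [lintegral_eq_zero_iff hc.measurable] at h
  have h2 := (Continuous.ae_eq_iff_eq _ hc continuous_const).1 h
  have := congrFun h2 ⟨e, by simp [he]⟩
  simp [he] at this

/-- Linear lower bounds for `B` are integrated over t in (1/2, 1) only, where 1/t stays bounded and
the additive constant remains finite. -/
theorem gradDensity_superlinear {B : ℝ → ℝ} (hB : IsEvenYoung B) {e : E} (he : ‖e‖ = 1)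
    {K : ℝ} (hK : 0 ≤ K) :
    ∃ C : ℝ, 0 ≤ C ∧ ∀ g : E, ENNReal.ofReal (K * ‖g‖) ≤ gradDensity B g + ENNReal.ofReal C := by
  set σ : Measure (Metric.sphere (0 : E) 1) := volume.toSphere
  set κ := ∫⁻ w : Metric.sphere (0 : E) 1, ENNReal.ofReal |inner ℝ (w : E) e| ∂σ with hκ
  have hκ0 : κ ≠ 0 := lintegral_sphere_abs_inner_ne_zero he
  have hκt : κ ≠ ⊤ := by
    refine ne_top_of_le_ne_top (b := σ univ) (measure_ne_top _ _) ?_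
    rw [← lintegral_one]
    refine lintegral_mono fun w => ?_
    have := abs_real_inner_le_norm (w : E) e
    rw [he, norm_eq_of_mem_sphere w] at this
    simpa using this
  -- The factor 2 offsets the length of (1/2, 1), and κ is the spherical integral of |ω · e|.
  obtain ⟨C, hC0, hC⟩ := hB.superlinear (2 * K / κ.toReal) (by positivity)
  set K' := 2 * K / κ.toReal
  have hpt : ∀ (x t : ℝ), t ∈ Ioo (1 / 2 : ℝ) 1 → ENNReal.ofReal (K' * |x|) ≤
      ENNReal.ofReal (B (t * x)) / ENNReal.ofReal t + ENNReal.ofReal (2 * C) := by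
    intro x t ht
    have ht0 : 0 < t := by linarith [ht.1]
    rw [← ENNReal.ofReal_div_of_pos ht0, ← ENNReal.ofReal_add (div_nonneg (hB.nonneg _) ht0.le)
      (by positivity)]
    apply ENNReal.ofReal_le_ofReal
    have h1 := hC (t * x)
    rw [abs_mul, abs_of_pos ht0] at h1
    have h2 : C ≤ 2 * C * t := by nlinarith [ht.1]
    rw [← sub_le_iff_le_add, le_div_iff₀ ht0]
    nlinarith
  have hw : ∀ x : ℝ, ENNReal.ofReal (K' / 2 * |x|) ≤ (∫⁻ t in Ioo (0 : ℝ) 1,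
      ENNReal.ofReal (B (t * x)) / ENNReal.ofReal t) + ENNReal.ofReal C := by
    intro x
    have h1 := setLIntegral_mono' (μ := volume) measurableSet_Ioo (hpt x)
    rw [lintegral_add_right _ measurable_const] at h1
    simp only [lintegral_const, Measure.restrict_apply_univ, Real.volume_Ioo] at h1
    rw [← ENNReal.ofReal_mul (by positivity), ← ENNReal.ofReal_mul (by positivity)] at h1
    calc _ = ENNReal.ofReal (K' * |x| * (1 - 1 / 2)) := by congr 1; ring
      _ ≤ _ := h1
      _ ≤ _ := by
        gcongr
        · norm_num
        · linarith
  refine ⟨C * σ.real univ, by positivity, fun g => ?_⟩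
  have h1 := lintegral_mono (μ := σ) fun w : Metric.sphere (0 : E) 1 => hw (inner ℝ (w : E) g)
  rw [lintegral_add_right _ measurable_const, lintegral_const] at h1
  have h2 : ∫⁻ w : Metric.sphere (0 : E) 1, ENNReal.ofReal (K' / 2 * |inner ℝ (w : E) g|) ∂σ =
      ENNReal.ofReal (K * ‖g‖) := by
    rw [lintegral_sphere_inner (fun x => ENNReal.ofReal (K' / 2 * |x|)) (by fun_prop) he]
    simp only [abs_mul, abs_norm, ← mul_assoc]
    have : 0 ≤ K' / 2 * ‖g‖ := by positivity
    simp only [ENNReal.ofReal_mul this]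
    rw [lintegral_const_mul' _ _ (by simp), ← hκ, ← ENNReal.ofReal_toReal hκt,
      ← ENNReal.ofReal_mul this]
    congr 1
    have : κ.toReal ≠ 0 := ENNReal.toReal_ne_zero.2 ⟨hκ0, hκt⟩
    simp only [K']
    field_simp
  rw [h2] at h1
  refine h1.trans (add_le_add le_rfl ?_)
  rw [ENNReal.ofReal_mul hC0, ofReal_measureReal]

end Spherical

/-! ### Strong L¹ compactness from strict convexity -/

section Compactness

variable {F : Type*} [NormedAddCommGroup F]

/-- A strictly convex function of linear growth. -/
noncomputable def japanese (p : F) : ℝ := √(1 + ‖p‖ ^ 2)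

theorem japanese_sq (p : F) : japanese p ^ 2 = 1 + ‖p‖ ^ 2 := Real.sq_sqrt (by positivity)

theorem one_le_japanese (p : F) : 1 ≤ japanese p := by
  rw [japanese, Real.one_le_sqrt]; nlinarith [sq_nonneg ‖p‖]

theorem japanese_le (p : F) : japanese p ≤ 1 + ‖p‖ := by
  rw [japanese, Real.sqrt_le_left (by positivity)]; nlinarith [norm_nonneg p]

theorem continuous_japanese : Continuous (japanese : F → ℝ) := by
  unfold japanese; fun_prop

variable {α : Type*} [MeasurableSpace α]

theorem exists_tendsto_of_cauchy [CompleteSpace F] {ν : Measure α} {h : ℕ → α → F}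
    (hint : ∀ j, Integrable (h j) ν)
    (hcau : ∀ ε : ℝ≥0∞, 0 < ε → ∃ N, ∀ i j, N ≤ j → j ≤ i → ∫⁻ x, ‖h i x - h j x‖ₑ ∂ν < ε) :
    ∃ g : α → F, Integrable g ν ∧ Tendsto (fun j => ∫⁻ x, ‖h j x - g x‖ₑ ∂ν) atTop (𝓝 0) := by
  have hc : CauchySeq fun j => (hint j).toL1 (h j) := by
    rw [EMetric.cauchySeq_iff]
    intro ε hε
    obtain ⟨N, hN⟩ := hcau ε hε
    refine ⟨N, fun i hi j hj => ?_⟩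
    rw [Integrable.edist_toL1_toL1]
    rcases le_total j i with hij | hij
    · simpa only [edist_eq_enorm_sub] using hN i j hj hij
    · simpa only [edist_comm (h i _), edist_eq_enorm_sub] using hN j i hi hij
  obtain ⟨g, hg⟩ := cauchySeq_tendsto_of_complete hc
  refine ⟨g, L1.integrable_coeFn g, ?_⟩
  have h2 := (tendsto_iff_edist_tendsto_0 ..).1 hg
  refine h2.congr fun j => ?_
  conv_lhs => rw [← Integrable.toL1_coeFn g (L1.integrable_coeFn g)]
  rw [Integrable.edist_toL1_toL1]
  simp only [edist_eq_enorm_sub]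

variable [InnerProductSpace ℝ F]

/-- Quantitative strict convexity. With d = ‖p - q‖², the parallelogram law gives (a + b)² - 4c² = d
- (a - b)². Cauchy–Schwarz gives (a² - b²)² ≤ d‖p + q‖², and ‖p + q‖² = 4c² - 4 ≤ (a + b)² - 4.
Hence 4d ≤ (a + b)²((a + b)² - 4c²), and the last factor is at most 4(a + b) times the midpoint gap.
-/
theorem norm_sub_sq_le_japanese_gap (p q : F) :
    ‖p - q‖ ^ 2 ≤ (japanese p + japanese q) ^ 3 *
      ((japanese p + japanese q) / 2 - japanese ((1 / 2 : ℝ) • (p + q))) := by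
  set a := japanese p
  set b := japanese q
  set c := japanese ((1 / 2 : ℝ) • (p + q))
  have ha : 1 ≤ a := one_le_japanese p
  have hb : 1 ≤ b := one_le_japanese q
  have hc : 1 ≤ c := one_le_japanese _
  have ha2 : a ^ 2 = 1 + ‖p‖ ^ 2 := japanese_sq p
  have hb2 : b ^ 2 = 1 + ‖q‖ ^ 2 := japanese_sq q
  have hc2 : c ^ 2 = 1 + ‖p + q‖ ^ 2 / 4 := by
    rw [japanese_sq, norm_smul]; norm_num; ring
  have hpar : ‖p + q‖ ^ 2 + ‖p - q‖ ^ 2 = 2 * (‖p‖ ^ 2 + ‖q‖ ^ 2) := by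
    have := parallelogram_law_with_norm ℝ p q
    nlinarith
  have hin : (a ^ 2 - b ^ 2) ^ 2 ≤ ‖p - q‖ ^ 2 * ‖p + q‖ ^ 2 := by
    have h1 : a ^ 2 - b ^ 2 = inner ℝ (p - q) (p + q) := by
      rw [ha2, hb2, inner_sub_left, inner_add_right, inner_add_right, real_inner_self_eq_norm_sq,
        real_inner_self_eq_norm_sq, real_inner_comm]; ring
    rw [h1, ← mul_pow, ← sq_abs]
    gcongr
    exact abs_real_inner_le_norm _ _
  set d := ‖p - q‖ ^ 2
  have hd : 0 ≤ d := sq_nonneg _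
  have hd4 : d = 2 * a ^ 2 + 2 * b ^ 2 - 4 * c ^ 2 := by linarith
  have hle : (a - b) ^ 2 ≤ d := by
    have hs : 0 < (a + b) ^ 2 := by positivity
    refine le_of_mul_le_mul_right ?_ hs
    calc (a - b) ^ 2 * (a + b) ^ 2 = (a ^ 2 - b ^ 2) ^ 2 := by ring
      _ ≤ d * ‖p + q‖ ^ 2 := hin
      _ ≤ d * (a + b) ^ 2 := by
        gcongr d * ?_
        have hab : 1 + ‖p‖ * ‖q‖ ≤ a * b := by
          refine le_of_sq_le_sq ?_ (by positivity)
          rw [mul_pow, ha2, hb2]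
          nlinarith [sq_nonneg (‖p‖ - ‖q‖)]
        have h2 : ‖p + q‖ ≤ ‖p‖ + ‖q‖ := norm_add_le p q
        nlinarith [norm_nonneg (p + q), norm_nonneg p, norm_nonneg q]
  have hcab : c ≤ (a + b) / 2 := by
    refine le_of_sq_le_sq ?_ (by positivity)
    nlinarith
  have key : 4 * d ≤ (a + b) ^ 2 * ((a + b) ^ 2 - 4 * c ^ 2) := by
    have h4 : ‖p + q‖ ^ 2 ≤ (a + b) ^ 2 - 4 := by nlinarith
    have h5 : d * ‖p + q‖ ^ 2 ≤ d * ((a + b) ^ 2 - 4) := by gcongr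
    have h6 : (a ^ 2 - b ^ 2) ^ 2 = (a + b) ^ 2 * (a - b) ^ 2 := by ring
    have h7 : (a + b) ^ 2 - 4 * c ^ 2 = d - (a - b) ^ 2 := by rw [hd4]; ring
    rw [h7]; nlinarith
  have h8 : (a + b) ^ 2 - 4 * c ^ 2 ≤ 4 * (a + b) * ((a + b) / 2 - c) := by nlinarith
  have h9 : 4 * d ≤ (a + b) ^ 2 * (4 * (a + b) * ((a + b) / 2 - c)) :=
    key.trans (by gcongr)
  nlinarith

theorem japanese_gap_nonneg (p q : F) :
    0 ≤ (japanese p + japanese q) / 2 - japanese ((1 / 2 : ℝ) • (p + q)) := by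
  have h := norm_sub_sq_le_japanese_gap p q
  have hs : 0 < (japanese p + japanese q) ^ 3 := by
    have := one_le_japanese p
    have := one_le_japanese q
    positivity
  exact nonneg_of_mul_nonneg_right ((sq_nonneg _).trans h) hs

/-- For bounded p and q the convexity gap controls the distance; otherwise superlinearity of Ψ
absorbs it with a small factor. -/
theorem enorm_sub_le_japanese_gap {Ψ : F → ℝ≥0∞}
    (hΨ : ∀ K : ℝ, 0 ≤ K → ∃ C : ℝ, 0 ≤ C ∧ ∀ p, ENNReal.ofReal (K * ‖p‖) ≤ Ψ p + ENNReal.ofReal C)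
    {ε : ℝ} (hε : 0 < ε) :
    ∃ C : ℝ, 0 ≤ C ∧ ∀ p q : F, ‖p - q‖ₑ ≤ ENNReal.ofReal ε +
      ENNReal.ofReal (C * ((japanese p + japanese q) / 2 - japanese ((1 / 2 : ℝ) • (p + q)))) +
      ENNReal.ofReal ε * (Ψ p + Ψ q) := by
  -- Of the resulting 4‖p‖, one half absorbs the constant ε c once ‖p‖ ≥ M; the other half dominates
  -- ‖p - q‖ when p is the larger vector.
  obtain ⟨c, hc0, hc⟩ := hΨ (4 / ε) (by positivity)
  set M := ε * c / 2 with hM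
  have hM0 : 0 ≤ M := by positivity
  have large : ∀ p : F, M ≤ ‖p‖ → ENNReal.ofReal (2 * ‖p‖) ≤ ENNReal.ofReal ε * Ψ p := by
    intro p hp
    have h1 := mul_le_mul_right (hc p) (ENNReal.ofReal ε)
    rw [mul_add, ← ENNReal.ofReal_mul hε.le, ← ENNReal.ofReal_mul hε.le] at h1
    have h2 : ε * (4 / ε * ‖p‖) = 2 * ‖p‖ + 2 * ‖p‖ := by field_simp; ring
    rw [h2, ENNReal.ofReal_add (by positivity) (by positivity)] at h1
    have h3 : ENNReal.ofReal (ε * c) ≤ ENNReal.ofReal (2 * ‖p‖) :=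
      ENNReal.ofReal_le_ofReal (by linarith)
    exact (ENNReal.add_le_add_iff_right ENNReal.ofReal_ne_top).1 (h1.trans (by gcongr))
  refine ⟨(2 * (1 + M)) ^ 3 / ε, by positivity, fun p q => ?_⟩
  rw [← ofReal_norm]
  have hn : ‖p - q‖ ≤ ‖p‖ + ‖q‖ := norm_sub_le p q
  by_cases hp : ‖p‖ ≤ M
  · by_cases hq : ‖q‖ ≤ M
    · refine le_trans ?_ le_self_add
      rw [← ENNReal.ofReal_add hε.le (mul_nonneg (by positivity) (japanese_gap_nonneg p q))]
      apply ENNReal.ofReal_le_ofReal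
      have h1 := norm_sub_sq_le_japanese_gap p q
      have h2 : japanese p + japanese q ≤ 2 * (1 + M) := by
        linarith [japanese_le p, japanese_le q]
      have h3 : 0 ≤ japanese p + japanese q := by
        linarith [one_le_japanese p, one_le_japanese q]
      have h4 := h1.trans (mul_le_mul_of_nonneg_right (pow_le_pow_left₀ h3 h2 3)
        (japanese_gap_nonneg p q))
      have h5 : ‖p - q‖ ≤ ε + ‖p - q‖ ^ 2 / ε := by
        rw [← sub_le_iff_le_add', le_div_iff₀ hε]
        nlinarith [sq_nonneg (‖p - q‖ - ε)]
      refine h5.trans ?_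
      rw [div_mul_eq_mul_div]
      gcongr
    · refine le_trans (le_trans ?_ (large q (le_of_not_ge hq))) ?_
      · exact ENNReal.ofReal_le_ofReal (by linarith)
      · rw [mul_add (ENNReal.ofReal ε)]; exact le_add_self.trans le_add_self
  · rcases le_total ‖p‖ ‖q‖ with hpq | hpq
    · refine le_trans (le_trans ?_ (large q (by linarith))) ?_
      · exact ENNReal.ofReal_le_ofReal (by linarith)
      · rw [mul_add (ENNReal.ofReal ε)]; exact le_add_self.trans le_add_self
    · refine le_trans (le_trans ?_ (large p (by linarith))) ?_
      · exact ENNReal.ofReal_le_ofReal (by linarith)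
      · rw [mul_add (ENNReal.ofReal ε)]; exact le_self_add.trans le_add_self

/-- In place of the Dunford–Pettis theorem: almost minimisers of a strictly convex functional over
a decreasing sequence of midpoint-convex families with bounded superlinear energy converge in
`L¹`. -/
theorem exists_seq_tendsto_of_midpoint [CompleteSpace F] {ν : Measure α} [IsFiniteMeasure ν] {Ψ : F → ℝ≥0∞}
    (hΨ : ∀ K : ℝ, 0 ≤ K → ∃ C : ℝ, 0 ≤ C ∧ ∀ p, ENNReal.ofReal (K * ‖p‖) ≤ Ψ p + ENNReal.ofReal C)
    {S : ℕ → Set (α → F)} (hS : Antitone S) (hne : ∀ j, (S j).Nonempty)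
    (hmid : ∀ j, ∀ p ∈ S j, ∀ q ∈ S j, (fun x => (1 / 2 : ℝ) • (p x + q x)) ∈ S j)
    (hmeas : ∀ p ∈ S 0, AEStronglyMeasurable p ν)
    {L : ℝ≥0∞} (hL : L ≠ ⊤) (hbd : ∀ p ∈ S 0, ∫⁻ x, Ψ (p x) ∂ν ≤ L)
    (hΨm : ∀ p ∈ S 0, AEMeasurable (fun x => Ψ (p x)) ν) :
    ∃ h : ℕ → α → F, (∀ j, h j ∈ S j) ∧ ∃ g : α → F, Integrable g ν ∧
      Tendsto (fun j => ∫⁻ x, ‖h j x - g x‖ₑ ∂ν) atTop (𝓝 0) := by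
  obtain ⟨C₁, hC₁, hone⟩ := hΨ 1 zero_le_one
  set M : ℝ≥0∞ := L + ENNReal.ofReal C₁ * ν univ
  have hM : M ≠ ⊤ := ENNReal.add_ne_top.2 ⟨hL, ENNReal.mul_ne_top (by simp) (measure_ne_top _ _)⟩
  have hSj : ∀ j, S j ⊆ S 0 := fun j => hS (Nat.zero_le j)
  have hnorm : ∀ p ∈ S 0, ∫⁻ x, ‖p x‖ₑ ∂ν ≤ M := by
    intro p hp
    calc ∫⁻ x, ‖p x‖ₑ ∂ν ≤ ∫⁻ x, (Ψ (p x) + ENNReal.ofReal C₁) ∂ν := by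
          refine lintegral_mono fun x => ?_
          simpa [ofReal_norm] using hone (p x)
      _ ≤ M := by
          rw [lintegral_add_right _ measurable_const, lintegral_const]
          exact add_le_add (hbd p hp) le_rfl
  have hint : ∀ p ∈ S 0, Integrable p ν := fun p hp =>
    ⟨hmeas p hp, (hnorm p hp).trans_lt hM.lt_top⟩
  have hjint : ∀ p ∈ S 0, Integrable (fun x => japanese (p x)) ν := by
    intro p hp
    refine Integrable.mono' ((integrable_const (1 : ℝ)).add (hint p hp).norm)
      (continuous_japanese.comp_aestronglyMeasurable (hmeas p hp)) (ae_of_all _ fun x => ?_)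
    rw [Real.norm_of_nonneg (zero_le_one.trans (one_le_japanese _))]
    exact japanese_le _
  set m : (α → F) → ℝ := fun p => ∫ x, japanese (p x) ∂ν with hm
  have hm0 : ∀ p, 0 ≤ m p := fun p =>
    integral_nonneg fun x => zero_le_one.trans (one_le_japanese _)
  have hmM : ∀ p ∈ S 0, m p ≤ ν.real univ + M.toReal := by
    intro p hp
    calc m p ≤ ∫ x, (1 + ‖p x‖) ∂ν := integral_mono (hjint p hp)
          ((integrable_const (1 : ℝ)).add (hint p hp).norm) fun x => japanese_le _
      _ = ν.real univ + ∫ x, ‖p x‖ ∂ν := by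
          rw [integral_add (integrable_const _) (hint p hp).norm]; simp
      _ ≤ _ := by
          gcongr
          rw [integral_norm_eq_lintegral_enorm (hmeas p hp)]
          exact ENNReal.toReal_mono hM (hnorm p hp)
  -- The infima increase as the families shrink and are bounded, so they converge.
  set I : ℕ → ℝ := fun j => sInf (m '' S j) with hI
  have hbelow : ∀ j, BddBelow (m '' S j) := fun j => ⟨0, by rintro _ ⟨p, -, rfl⟩; exact hm0 p⟩
  have hImono : Monotone I := fun i j hij =>
    csInf_le_csInf (hbelow i) ((hne j).image m) (image_mono (hS hij))
  have hIbdd : BddAbove (range I) := by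
    refine ⟨ν.real univ + M.toReal, ?_⟩
    rintro _ ⟨j, rfl⟩
    obtain ⟨p, hp⟩ := hne j
    exact (csInf_le (hbelow j) (mem_image_of_mem m hp)).trans (hmM p (hSj j hp))
  have hItend := tendsto_atTop_ciSup hImono hIbdd
  set I' := ⨆ j, I j
  have hIle : ∀ j, I j ≤ I' := fun j => le_ciSup hIbdd j
  have hex : ∀ j : ℕ, ∃ p ∈ S j, m p < I j + 1 / ((j : ℝ) + 1) := by
    intro j
    obtain ⟨_, ⟨p, hp, rfl⟩, h2⟩ := exists_lt_of_csInf_lt ((hne j).image m)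
      (show sInf (m '' S j) < I j + 1 / ((j : ℝ) + 1) from lt_add_of_pos_right _ (by positivity))
    exact ⟨p, hp, h2⟩
  choose h hhS hh using hex
  refine ⟨h, hhS, exists_tendsto_of_cauchy (fun j => hint _ (hSj j (hhS j))) fun η hη => ?_⟩
  set τ : ℕ → ℝ := fun j => (I' - I j) + 1 / ((j : ℝ) + 1) with hτ
  have hτ0 : Tendsto τ atTop (𝓝 0) := by
    have := (tendsto_const_nhds (x := I')).sub hItend |>.add tendsto_one_div_add_atTop_nhds_zero_nat
    rwa [sub_self, zero_add] at this
  -- For j ≤ i the midpoint of h i and h j lies in S j, so its functional is at least I j, while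
  -- both endpoints are almost minimal; their mean gap is therefore small.
  have hgap : ∀ i j, j ≤ i → ∫ x, ((japanese (h i x) + japanese (h j x)) / 2 -
      japanese ((1 / 2 : ℝ) • (h i x + h j x))) ∂ν ≤ τ j := by
    intro i j hij
    have hi := hjint _ (hSj i (hhS i))
    have hj := hjint _ (hSj j (hhS j))
    have hmem := hmid j _ (hS hij (hhS i)) _ (hhS j)
    have hsum : Integrable (fun x => (japanese (h i x) + japanese (h j x)) / 2) ν :=
      (hi.add hj).div_const 2
    rw [integral_sub hsum (hjint _ (hSj j hmem)), integral_div, integral_add hi hj]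
    have h1 : I j ≤ m fun x => (1 / 2 : ℝ) • (h i x + h j x) :=
      csInf_le (hbelow j) (mem_image_of_mem m hmem)
    have h2 := hh i
    have h3 := hh j
    have h4 : 1 / ((i : ℝ) + 1) ≤ 1 / ((j : ℝ) + 1) := by gcongr
    have h5 := hIle i
    have h6 := hIle j
    simp only [hm, hτ] at *
    linarith
  have hest : ∀ ε : ℝ, 0 < ε → ∃ C : ℝ, 0 ≤ C ∧ ∀ i j, j ≤ i → ∫⁻ x, ‖h i x - h j x‖ₑ ∂ν ≤
      ENNReal.ofReal ε * (ν univ + (L + L)) + ENNReal.ofReal (C * τ j) := by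
    intro ε hε
    obtain ⟨C, hC0, hC⟩ := enorm_sub_le_japanese_gap hΨ hε
    refine ⟨C, hC0, fun i j hij => ?_⟩
    have hi := hSj i (hhS i)
    have hj := hSj j (hhS j)
    have hmem := hSj j (hmid j _ (hS hij (hhS i)) _ (hhS j))
    have hgi : Integrable (fun x => (japanese (h i x) + japanese (h j x)) / 2 -
        japanese ((1 / 2 : ℝ) • (h i x + h j x))) ν :=
      (((hjint _ hi).add (hjint _ hj)).div_const 2).sub (hjint _ hmem)
    have hΨij : AEMeasurable (fun x => ENNReal.ofReal ε * (Ψ (h i x) + Ψ (h j x))) ν :=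
      ((hΨm _ hi).add (hΨm _ hj)).const_mul _
    calc _ ≤ _ := lintegral_mono fun x => hC (h i x) (h j x)
      _ = ENNReal.ofReal ε * ν univ + ENNReal.ofReal (C * ∫ x, ((japanese (h i x) +
            japanese (h j x)) / 2 - japanese ((1 / 2 : ℝ) • (h i x + h j x))) ∂ν) +
          ENNReal.ofReal ε * (∫⁻ x, Ψ (h i x) ∂ν + ∫⁻ x, Ψ (h j x) ∂ν) := by
        rw [lintegral_add_right' _ hΨij,
          lintegral_add_left measurable_const, lintegral_const, lintegral_const_mul' _ _ (by simp),
          lintegral_add_left' (hΨm _ hi), ← integral_const_mul,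
          ofReal_integral_eq_lintegral_ofReal (hgi.const_mul C)
            (ae_of_all _ fun x => mul_nonneg hC0 (japanese_gap_nonneg _ _))]
      _ ≤ ENNReal.ofReal ε * ν univ + ENNReal.ofReal (C * τ j) + ENNReal.ofReal ε * (L + L) := by
        gcongr
        · exact hgap i j hij
        · exact hbd _ hi
        · exact hbd _ hj
      _ = _ := by ring
  set Q := ν univ + (L + L)
  have hQ : Q ≠ ⊤ := by simp [Q, hL]
  have hη2 : 0 < η / 2 := ENNReal.half_pos hη.ne'
  -- First ε is fixed to make the energy term small; C then depends on ε, and j is taken large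
  -- afterwards.
  have hεex : ∃ ε : ℝ, 0 < ε ∧ ENNReal.ofReal ε * Q < η / 2 := by
    have h1 : Tendsto (fun ε : ℝ => ENNReal.ofReal ε * Q) (𝓝[>] 0) (𝓝 (ENNReal.ofReal 0 * Q)) :=
      ENNReal.Tendsto.mul_const
        ((ENNReal.continuous_ofReal.tendsto 0).mono_left nhdsWithin_le_nhds) (Or.inr hQ)
    rw [ENNReal.ofReal_zero, zero_mul] at h1
    obtain ⟨ε, h2, h3⟩ := ((h1.eventually_lt_const hη2).and self_mem_nhdsWithin).exists
    exact ⟨ε, h3, h2⟩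
  obtain ⟨ε, hε0, hε⟩ := hεex
  obtain ⟨C, hC0, hC⟩ := hest ε hε0
  have h1 : Tendsto (fun j => ENNReal.ofReal (C * τ j)) atTop (𝓝 0) := by
    have := ENNReal.tendsto_ofReal (hτ0.const_mul C)
    simpa using this
  obtain ⟨N, hN⟩ := eventually_atTop.1 (h1.eventually_lt_const hη2)
  refine ⟨N, fun i j hj hij => (hC i j hij).trans_lt ?_⟩
  calc _ < η / 2 + η / 2 := ENNReal.add_lt_add hε (hN j hj)
    _ = η := ENNReal.add_halves η

end Compactness

/-! ### Mollification -/

section Mollify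

open scoped Convolution

variable {n : ℕ}

local notation "E" => EuclideanSpace ℝ (Fin n)

/-- Smooth probability densities supported in the ball of radius `δ`. -/
structure IsKernel (δ : ℝ) (ρ : E → ℝ) : Prop where
  contDiff : ContDiff ℝ (⊤ : ℕ∞) ρ
  nonneg : ∀ x, 0 ≤ ρ x
  integral_eq_one : ∫ x, ρ x = 1
  support_subset : Function.support ρ ⊆ Metric.ball 0 δ

namespace IsKernel

variable {δ : ℝ} {ρ ρ' : EuclideanSpace ℝ (Fin n) → ℝ}

theorem hasCompactSupport (hρ : IsKernel δ ρ) : HasCompactSupport ρ :=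
  HasCompactSupport.of_support_subset_isCompact (isCompact_closedBall 0 δ)
    (hρ.support_subset.trans Metric.ball_subset_closedBall)

theorem continuous (hρ : IsKernel δ ρ) : Continuous ρ := hρ.contDiff.continuous

theorem integrable (hρ : IsKernel δ ρ) : Integrable ρ :=
  hρ.continuous.integrable_of_hasCompactSupport hρ.hasCompactSupport

theorem mono {δ' : ℝ} (hρ : IsKernel δ ρ) (h : δ ≤ δ') : IsKernel δ' ρ :=
  ⟨hρ.contDiff, hρ.nonneg, hρ.integral_eq_one,
    hρ.support_subset.trans (Metric.ball_subset_ball h)⟩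

/-- This supplies the midpoint-convexity that the compactness argument needs. -/
theorem midpoint (hρ : IsKernel δ ρ) (hρ' : IsKernel δ ρ') :
    IsKernel δ ((1 / 2 : ℝ) • (ρ + ρ')) := by
  have hsm : ContDiff ℝ (⊤ : ℕ∞) ((1 / 2 : ℝ) • (ρ + ρ')) :=
    (hρ.contDiff.add hρ'.contDiff).const_smul (1 / 2 : ℝ)
  refine ⟨hsm, fun x => ?_, ?_, fun x hx => ?_⟩
  · have := hρ.nonneg x
    have := hρ'.nonneg x
    simp only [Pi.smul_apply, Pi.add_apply, smul_eq_mul]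
    positivity
  · simp only [Pi.smul_apply, Pi.add_apply]
    rw [integral_smul, integral_add hρ.integrable hρ'.integrable, hρ.integral_eq_one,
      hρ'.integral_eq_one]
    norm_num
  · by_contra h
    have h1 : ρ x = 0 := by
      by_contra h'; exact h (hρ.support_subset h')
    have h2 : ρ' x = 0 := by
      by_contra h'; exact h (hρ'.support_subset h')
    simp [h1, h2] at hx

theorem exists_of_pos (hδ : 0 < δ) : ∃ ρ : E → ℝ, IsKernel δ ρ := by
  let φ : ContDiffBump (0 : E) := ⟨δ / 2, δ, by positivity, by linarith⟩
  refine ⟨φ.normed volume, φ.contDiff_normed, fun x => φ.nonneg_normed x, φ.integral_normed, ?_⟩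
  rw [φ.support_normed_eq]

theorem convolutionExists {u : E → ℝ} (hρ : IsKernel δ ρ) (hu : LocallyIntegrable u) :
    ConvolutionExists ρ u (ContinuousLinearMap.lsmul ℝ ℝ) volume :=
  hρ.hasCompactSupport.convolutionExists_left _ hρ.continuous hu

theorem contDiff_convolution {u : E → ℝ} (hρ : IsKernel δ ρ) (hu : LocallyIntegrable u) :
    ContDiff ℝ (⊤ : ℕ∞) (ρ ⋆ u) :=
  hρ.hasCompactSupport.contDiff_convolution_left _ hρ.contDiff hu

/-- The probability measure with density `ρ`. -/
noncomputable def measure (ρ : E → ℝ) : Measure E :=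
  volume.withDensity fun t => ((ρ t).toNNReal : ℝ≥0∞)

theorem isProbabilityMeasure (hρ : IsKernel δ ρ) : IsProbabilityMeasure (measure ρ) := by
  refine ⟨?_⟩
  rw [measure, withDensity_apply _ .univ, Measure.restrict_univ]
  change ∫⁻ t, ENNReal.ofReal (ρ t) = 1
  rw [← ofReal_integral_eq_lintegral_ofReal hρ.integrable (ae_of_all _ hρ.nonneg),
    hρ.integral_eq_one, ENNReal.ofReal_one]

theorem integrable_measure {u : E → ℝ} (hρ : IsKernel δ ρ) (hu : LocallyIntegrable u) (x : E) :
    Integrable (fun t => u (x - t)) (measure ρ) := by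
  rw [measure, integrable_withDensity_iff_integrable_smul hρ.continuous.measurable.real_toNNReal]
  have := (hρ.convolutionExists hu x).integrable
  refine this.congr (ae_of_all _ fun t => ?_)
  simp [NNReal.smul_def, hρ.nonneg t]

theorem convolution_eq_integral {u : E → ℝ} (hρ : IsKernel δ ρ) (x : E) :
    (ρ ⋆ u) x = ∫ t, u (x - t) ∂measure ρ := by
  rw [measure, integral_withDensity_eq_integral_smul hρ.continuous.measurable.real_toNNReal,
    convolution_def]
  refine integral_congr_ae (ae_of_all _ fun t => ?_)
  simp [NNReal.smul_def, hρ.nonneg t]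

end IsKernel

theorem IsEvenYoung.ofReal_integral_le {B : ℝ → ℝ} (hB : IsEvenYoung B) {α : Type*}
    [MeasurableSpace α] {P : Measure α} [IsProbabilityMeasure P] {f : α → ℝ}
    (hf : Integrable f P) :
    ENNReal.ofReal (B (∫ t, f t ∂P)) ≤ ∫⁻ t, ENNReal.ofReal (B (f t)) ∂P := by
  by_cases h : ∫⁻ t, ENNReal.ofReal (B (f t)) ∂P = ⊤
  · simp [h]
  have hm : AEStronglyMeasurable (fun t => B (f t)) P :=
    hB.continuous.comp_aestronglyMeasurable hf.1
  have hi : Integrable (fun t => B (f t)) P :=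
    (lintegral_ofReal_ne_top_iff_integrable hm (ae_of_all _ fun t => hB.nonneg _)).1 h
  rw [← ofReal_integral_eq_lintegral_ofReal hi (ae_of_all _ fun t => hB.nonneg _)]
  exact ENNReal.ofReal_le_ofReal (hB.convex.map_integral_le hB.continuous.continuousOn
    isClosed_univ (ae_of_all _ fun _ => mem_univ _) hf hi)

theorem fracEnergy_congr_ae {B : ℝ → ℝ} {s : ℝ} {u u' : E → ℝ} (h : u =ᵐ[volume] u') :
    fracEnergy B s u = fracEnergy B s u' := by
  unfold fracEnergy
  congr 1
  have h1 := Measure.quasiMeasurePreserving_fst (μ := (volume : Measure E))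
    (ν := (volume : Measure E)) |>.ae_eq_comp h
  have h2 := Measure.quasiMeasurePreserving_snd (μ := (volume : Measure E))
    (ν := (volume : Measure E)) |>.ae_eq_comp h
  refine lintegral_congr_ae ?_
  filter_upwards [h1, h2] with p hp1 hp2
  simp only [Function.comp_apply] at hp1 hp2
  rw [hp1, hp2]

theorem IsEvenYoung.abs_div {B : ℝ → ℝ} (hB : IsEvenYoung B) (x : ℝ) {y : ℝ} (hy : 0 ≤ y) :
    B (|x| / y) = B (x / y) := by
  rw [← hB.abs_eq (x / y), _root_.abs_div, abs_of_nonneg hy]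

theorem IsEvenYoung.measurable_quotient {B : ℝ → ℝ} (hB : IsEvenYoung B) (s : ℝ) {u : E → ℝ}
    (hu : Measurable u) : Measurable fun p : E × E =>
      ENNReal.ofReal (B (|u p.1 - u p.2| / ‖p.1 - p.2‖ ^ s) / ‖p.1 - p.2‖ ^ n) := by
  have h := hB.continuous.measurable
  have h1 : Measurable fun p : E × E => |u p.1 - u p.2| / ‖p.1 - p.2‖ ^ s := by fun_prop
  exact ((h.comp h1).div (by fun_prop)).ennreal_ofReal

/-- Mollification does not increase the fractional energy. -/
theorem fracEnergy_convolution_le {B : ℝ → ℝ} (hB : IsEvenYoung B) (s : ℝ) {δ : ℝ} {ρ u : E → ℝ}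
    (hρ : IsKernel δ ρ) (hu : LocallyIntegrable u) :
    fracEnergy B s (ρ ⋆ u) ≤ fracEnergy B s u := by
  wlog hum : Measurable u generalizing u
  · have hae := hu.aestronglyMeasurable.ae_eq_mk
    rw [fracEnergy_congr_ae hae, convolution_congr (L := ContinuousLinearMap.lsmul ℝ ℝ)
      (ae_eq_refl ρ) hae]
    exact this (hu.congr hae) hu.aestronglyMeasurable.stronglyMeasurable_mk.measurable
  have := hρ.isProbabilityMeasure
  set P := IsKernel.measure ρ
  unfold fracEnergy
  gcongr ENNReal.ofReal (1 - s) * ?_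
  set G : E × E → ℝ≥0∞ := fun p =>
    ENNReal.ofReal (B (|u p.1 - u p.2| / ‖p.1 - p.2‖ ^ s) / ‖p.1 - p.2‖ ^ n) with hG
  have hGm : Measurable G := hB.measurable_quotient s hum
  -- The diagonal shift by (t, t) leaves x - y unchanged, so the quotient of ρ ⋆ u is a mean of
  -- shifted quotients of u and Jensen's inequality applies.
  calc _ ≤ ∫⁻ p : E × E, ∫⁻ t, G (p - (t, t)) ∂P := by
        refine lintegral_mono fun p => ?_
        have hd : 0 ≤ ‖p.1 - p.2‖ ^ s := by positivity
        have hsub : (ρ ⋆ u) p.1 - (ρ ⋆ u) p.2 = ∫ t, (u (p.1 - t) - u (p.2 - t)) ∂P := by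
          rw [hρ.convolution_eq_integral, hρ.convolution_eq_integral,
            integral_sub (hρ.integrable_measure hu _) (hρ.integrable_measure hu _)]
        simp only [hG, Prod.fst_sub, Prod.snd_sub, sub_sub_sub_cancel_right, hB.abs_div _ hd,
          div_eq_mul_inv _ (‖p.1 - p.2‖ ^ n)]
        rw [ENNReal.ofReal_mul (hB.nonneg _), hsub, ← integral_div]
        simp_rw [ENNReal.ofReal_mul (hB.nonneg _)]
        rw [lintegral_mul_const' _ _ ENNReal.ofReal_ne_top]
        gcongr
        exact hB.ofReal_integral_le
          (((hρ.integrable_measure hu _).sub (hρ.integrable_measure hu _)).div_const _)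
    _ = ∫⁻ t, (∫⁻ p : E × E, G (p - (t, t))) ∂P := by
        rw [lintegral_lintegral_swap]
        exact (hGm.comp (f := fun q : (E × E) × E => q.1 - (q.2, q.2)) (by fun_prop)).aemeasurable
    _ = ∫⁻ p, G p := by
        have h : ∀ t : E, ∫⁻ p : E × E, G (p - (t, t)) = ∫⁻ p, G p := fun t =>
          lintegral_sub_right_eq_self (μ := (volume : Measure E).prod volume) G (t, t)
        simp [h]

/-- The kernel is Lipschitz. The bound is linear in ‖h‖ with a constant independent of d, so it
survives division by the step length. -/
theorem enorm_convolution_sub_le {δ : ℝ} {ρ : E → ℝ} (hρ : IsKernel δ ρ) (x : E) :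
    ∃ C : NNReal, ∀ d : E → ℝ, LocallyIntegrable d → ∀ h : E, ‖h‖ ≤ 1 →
      ‖(ρ ⋆ d) (x + h) - (ρ ⋆ d) x‖ₑ ≤
        C * ‖h‖ₑ * ∫⁻ t in Metric.closedBall 0 (‖x‖ + 1 + δ), ‖d t‖ₑ := by
  obtain ⟨C, hC⟩ := hρ.contDiff.lipschitzWith_of_hasCompactSupport hρ.hasCompactSupport
    (by exact_mod_cast WithTop.top_ne_zero)
  refine ⟨C, fun d hd h hh => ?_⟩
  have hi : ∀ y, Integrable fun t => ρ (y - t) • d t := fun y =>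
    (hρ.convolutionExists hd y).integrable_swap
  rw [convolution_lsmul_swap, convolution_lsmul_swap, ← integral_sub (hi _) (hi _),
    ← lintegral_const_mul' _ _ (by finiteness),
    ← lintegral_indicator Metric.isClosed_closedBall.measurableSet]
  refine (enorm_integral_le_lintegral_enorm _).trans (lintegral_mono fun t => ?_)
  have hz : ∀ y, ‖y‖ ≤ ‖x‖ + 1 → t ∉ Metric.closedBall (0 : E) (‖x‖ + 1 + δ) → ρ (y - t) = 0 := by
    intro y hy ht
    by_contra hne
    have h1 := hρ.support_subset hne
    rw [mem_ball_zero_iff] at h1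
    apply ht
    rw [mem_closedBall_zero_iff]
    have : ‖t‖ ≤ ‖y‖ + ‖y - t‖ := by
      simpa using norm_sub_le y (y - t)
    linarith
  by_cases ht : t ∈ Metric.closedBall (0 : E) (‖x‖ + 1 + δ)
  · rw [indicator_of_mem ht, ← sub_smul, smul_eq_mul, enorm_mul]
    gcongr
    have := hC (x + h - t) (x - t)
    rw [edist_eq_enorm_sub, edist_eq_enorm_sub] at this
    rwa [show x + h - t - (x - t) = h by abel] at this
  · rw [indicator_of_notMem ht, hz x (by linarith) ht,
      hz (x + h) ((norm_add_le x h).trans (by linarith)) ht]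
    simp

/-- Split u_k = u + (u_k - u): the first part is smooth after convolution, the second is controlled
by its local L¹ norm. The rates of r_k and of u_k → u need not be related. -/
theorem tendsto_convolution_quotient {δ : ℝ} {ρ u : E → ℝ} (hρ : IsKernel δ ρ)
    (hu : LocallyIntegrable u) {uk : ℕ → E → ℝ} (huk : ∀ k, LocallyIntegrable (uk k))
    (hconv : ∀ R : ℝ, Tendsto (fun k => ∫⁻ x in Metric.closedBall 0 R, ‖uk k x - u x‖ₑ)
      atTop (𝓝 0)) {r : ℕ → ℝ} (hr0 : ∀ k, 0 < r k) (hr : Tendsto r atTop (𝓝 0)) (x w : E) :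
    Tendsto (fun k => ((ρ ⋆ uk k) (x + r k • w) - (ρ ⋆ uk k) x) / r k) atTop
      (𝓝 (fderiv ℝ (ρ ⋆ u) x w)) := by
  have hdiff : DifferentiableAt ℝ (ρ ⋆ u) x :=
    (hρ.contDiff_convolution hu).differentiable (by simp) x
  have h1 : Tendsto (fun k => ((ρ ⋆ u) (x + r k • w) - (ρ ⋆ u) x) / r k) atTop
      (𝓝 (fderiv ℝ (ρ ⋆ u) x w)) := by
    have := hdiff.hasFDerivAt.hasLineDerivAt w
    have := this.tendsto_slope_zero.comp (f := r)
      (tendsto_nhdsWithin_iff.2 ⟨hr, .of_forall fun k => (hr0 k).ne'⟩)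
    refine this.congr fun k => ?_
    simp [div_eq_inv_mul]
  obtain ⟨C, hC⟩ := enorm_convolution_sub_le hρ x
  have hdecomp : ∀ k y, (ρ ⋆ uk k) y = (ρ ⋆ u) y + (ρ ⋆ (uk k - u)) y := by
    intro k y
    rw [← (hρ.convolutionExists hu y).distrib_add (hρ.convolutionExists ((huk k).sub hu) y)]
    simp
  have h2 : Tendsto (fun k => ((ρ ⋆ (uk k - u)) (x + r k • w) - (ρ ⋆ (uk k - u)) x) / r k) atTop
      (𝓝 0) := by
    rw [tendsto_zero_iff_enorm_tendsto_zero]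
    have h3 : Tendsto (fun k => C * ‖w‖ₑ * ∫⁻ t in Metric.closedBall 0 (‖x‖ + 1 + δ),
        ‖(uk k - u) t‖ₑ) atTop (𝓝 0) := by
      have := ENNReal.Tendsto.const_mul (a := C * ‖w‖ₑ) (hconv (‖x‖ + 1 + δ))
        (Or.inr (by finiteness))
      simpa using this
    refine tendsto_of_tendsto_of_tendsto_of_le_of_le' tendsto_const_nhds h3
      (.of_forall fun _ => bot_le) ?_
    have hev : ∀ᶠ k in atTop, ‖r k • w‖ ≤ 1 := by
      have : Tendsto (fun k => ‖r k • w‖) atTop (𝓝 0) := by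
        simpa using (hr.smul_const w).norm
      exact this.eventually_le_const one_pos
    filter_upwards [hev] with k hk
    have h4 := hC _ ((huk k).sub hu) _ hk
    rw [div_eq_mul_inv, enorm_mul, enorm_inv (hr0 k).ne']
    rw [← div_eq_mul_inv, ENNReal.div_le_iff (by simp [(hr0 k).ne']) (by simp)]
    refine h4.trans_eq ?_
    rw [enorm_smul]
    ring
  have := h1.add h2
  rw [add_zero] at this
  refine this.congr fun k => ?_
  rw [hdecomp, hdecomp]
  ring

end Mollify

/-! ### Polar coordinates and the limit s → 1 -/

section Polar

open scoped Convolution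

variable {n : ℕ}

local notation "E" => EuclideanSpace ℝ (Fin n)

theorem lintegral_eq_lintegral_sphere (hn : 1 ≤ n) {f : E → ℝ≥0∞} (hf : Measurable f) :
    ∫⁻ x, f x = ∫⁻ w : Metric.sphere (0 : E) 1, (∫⁻ r in Ioi (0 : ℝ),
      f (r • (w : E)) * ENNReal.ofReal (r ^ (n - 1))) ∂volume.toSphere := by
  have : Nonempty (Fin n) := ⟨⟨0, hn⟩⟩
  have hmp := (volume : Measure E).measurePreserving_homeomorphUnitSphereProd
  rw [finrank_euclideanSpace_fin] at hmp
  have hg : Measurable fun p : Metric.sphere (0 : E) 1 × Ioi (0 : ℝ) =>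
      f ((p.2 : ℝ) • (p.1 : E)) := hf.comp (Continuous.measurable (by fun_prop))
  have h0 : ∫⁻ x, f x = ∫⁻ x in ({0}ᶜ : Set E), f x := by
    rw [restrict_compl_singleton]
  rw [h0, ← lintegral_subtype_comap (measurableSet_singleton _).compl]
  have h1 : ∀ x : ({0}ᶜ : Set E), f x =
      f (((homeomorphUnitSphereProd E x).2 : ℝ) • ((homeomorphUnitSphereProd E x).1 : E)) := by
    intro x
    have hx : ‖(x : E)‖ ≠ 0 := norm_ne_zero_iff.2 x.2
    simp [smul_smul, hx]
  rw [lintegral_congr h1, hmp.lintegral_comp hg, lintegral_prod _ hg.aemeasurable]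
  refine lintegral_congr fun w => ?_
  have hd : Measurable fun r : Ioi (0 : ℝ) => ENNReal.ofReal ((r : ℝ) ^ (n - 1)) := by fun_prop
  have hgw : Measurable fun r : Ioi (0 : ℝ) => f ((r : ℝ) • (w : E)) :=
    hg.comp (f := fun r : Ioi (0 : ℝ) => (w, r)) (by fun_prop)
  rw [Measure.volumeIoiPow, lintegral_withDensity_eq_lintegral_mul _ hd hgw,
    ← lintegral_subtype_comap measurableSet_Ioi]
  refine lintegral_congr fun r => ?_
  simp [mul_comm]

/-- Put r = t^(1/(1-s)). Then (1 - s) dr/r = dt/t and r^(1-s) = t, so q/r^s = t(q/r). The inequality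
comes only from discarding r ≥ 1. -/
theorem lintegral_rpow_le {B : ℝ → ℝ} (hB : IsEvenYoung B) {s : ℝ} (hs : s ∈ Ioo (0 : ℝ) 1)
    (q : ℝ → ℝ) :
    ∫⁻ t in Ioo (0 : ℝ) 1, ENNReal.ofReal (B (t * (q (t ^ (1 - s)⁻¹) / t ^ (1 - s)⁻¹))) /
      ENNReal.ofReal t ≤
    ENNReal.ofReal (1 - s) * ∫⁻ r in Ioi (0 : ℝ), ENNReal.ofReal (B (|q r| / r ^ s) / r) := by
  have hs1 : 0 < 1 - s := sub_pos.2 hs.2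
  set p := (1 - s)⁻¹ with hp
  have hp0 : 0 < p := inv_pos.2 hs1
  have hsub : (fun t : ℝ => t ^ p) '' Ioo (0 : ℝ) 1 ⊆ Ioi 0 := by
    rintro _ ⟨t, ht, rfl⟩
    exact Real.rpow_pos_of_pos ht.1 p
  refine le_trans ?_ (mul_le_mul_right (lintegral_mono_set hsub) _)
  rw [lintegral_image_eq_lintegral_abs_deriv_mul measurableSet_Ioo
    (f' := fun t => p * t ^ (p - 1))
    (fun t ht => (Real.hasDerivAt_rpow_const (Or.inl (ne_of_gt ht.1))).hasDerivWithinAt)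
    (fun x hx y hy h => (Real.rpow_left_inj hx.1.le hy.1.le hp0.ne').1 h),
    ← lintegral_const_mul' _ _ ENNReal.ofReal_ne_top]
  refine le_of_eq (setLIntegral_congr_fun measurableSet_Ioo fun t ht => ?_)
  have ht0 : 0 < t := ht.1
  have htp : 0 < t ^ p := Real.rpow_pos_of_pos ht0 p
  have h1 : (t ^ p) ^ s = t ^ p / t := by
    rw [← Real.rpow_mul ht0.le, ← Real.rpow_sub_one ht0.ne']
    congr 1
    rw [hp]; field_simp; ring
  have h2 : B (|q (t ^ p)| / (t ^ p) ^ s) = B (t * (q (t ^ p) / t ^ p)) := by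
    rw [hB.abs_div _ (by positivity), h1]
    congr 1; field_simp
  simp only [h2]
  rw [← ENNReal.ofReal_div_of_pos ht0, ← ENNReal.ofReal_mul (abs_nonneg _),
    ← ENNReal.ofReal_mul hs1.le, abs_of_pos (mul_pos hp0 (Real.rpow_pos_of_pos ht0 _)),
    Real.rpow_sub_one ht0.ne', hp]
  congr 1
  field_simp

/-- With y = x + h and h in polar coordinates, the Jacobian r^(n-1) against r^(-n) leaves the 1/r of
the one-dimensional substitution. -/
theorem lintegral_polar_le_fracEnergy (hn : 1 ≤ n) {B : ℝ → ℝ} (hB : IsEvenYoung B) {s : ℝ}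
    (hs : s ∈ Ioo (0 : ℝ) 1) {v : E → ℝ} (hv : Measurable v) :
    ∫⁻ x, ∫⁻ w : Metric.sphere (0 : E) 1, (∫⁻ t in Ioo (0 : ℝ) 1,
      ENNReal.ofReal (B (t * ((v (x + t ^ (1 - s)⁻¹ • (w : E)) - v x) / t ^ (1 - s)⁻¹))) /
        ENNReal.ofReal t) ∂volume.toSphere ≤ fracEnergy B s v := by
  have hm := hB.measurable_quotient s hv
  unfold fracEnergy
  rw [Measure.volume_eq_prod, lintegral_prod _ hm.aemeasurable,
    ← lintegral_const_mul' _ _ ENNReal.ofReal_ne_top]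
  refine lintegral_mono fun x => ?_
  have hshift : ∫⁻ y, ENNReal.ofReal (B (|v x - v y| / ‖x - y‖ ^ s) / ‖x - y‖ ^ n) =
      ∫⁻ h, ENNReal.ofReal (B (|v (x + h) - v x| / ‖h‖ ^ s) / ‖h‖ ^ n) := by
    rw [← lintegral_add_left_eq_self _ x]
    refine lintegral_congr fun h => ?_
    rw [abs_sub_comm]
    simp
  have hmx : Measurable fun h : E =>
      ENNReal.ofReal (B (|v (x + h) - v x| / ‖h‖ ^ s) / ‖h‖ ^ n) := by
    have h1 : Measurable fun h : E => |v (x + h) - v x| / ‖h‖ ^ s := by fun_prop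
    exact ((hB.continuous.measurable.comp h1).div (by fun_prop)).ennreal_ofReal
  simp only
  rw [hshift, lintegral_eq_lintegral_sphere hn hmx,
    ← lintegral_const_mul' _ _ ENNReal.ofReal_ne_top]
  refine lintegral_mono fun w => (lintegral_rpow_le hB hs
    (fun r => v (x + r • (w : E)) - v x)).trans_eq ?_
  congr 1
  refine setLIntegral_congr_fun measurableSet_Ioi fun r hr => ?_
  have hr0 : 0 < r := hr
  have hnr : ‖r • (w : E)‖ = r := by simp [norm_smul, abs_of_pos hr0]
  simp only [hnr]
  rw [← ENNReal.ofReal_mul (div_nonneg (hB.nonneg _) (by positivity))]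
  congr 1
  -- Writing n = m + 1 removes the truncated subtraction in n - 1.
  obtain ⟨m, rfl⟩ := Nat.exists_eq_add_of_le' hn
  rw [Nat.add_sub_cancel, pow_succ]
  field_simp

/-- Fatou's lemma in x, ω and t: for fixed t in (0,1) the step t^(1/(1-s_k)) tends to 0, so the
quotients converge pointwise. -/
theorem lintegral_gradDensity_le_liminf (hn : 1 ≤ n) {B : ℝ → ℝ} (hB : IsEvenYoung B)
    {δ : ℝ} {ρ u : E → ℝ} (hρ : IsKernel δ ρ)
    (hu : LocallyIntegrable u) {uk : ℕ → E → ℝ} (huk : ∀ k, LocallyIntegrable (uk k))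
    (hconv : ∀ R : ℝ, Tendsto (fun k => ∫⁻ x in Metric.closedBall 0 R, ‖uk k x - u x‖ₑ)
      atTop (𝓝 0))
    {s : ℕ → ℝ} (hs : ∀ k, s k ∈ Ioo (0 : ℝ) 1) (hs1 : Tendsto s atTop (𝓝 1)) :
    ∫⁻ x, gradDensity B (gradient (ρ ⋆ u) x) ≤
      liminf (fun k => fracEnergy B (s k) (uk k)) atTop := by
  have hcont : ∀ k, Continuous (ρ ⋆ uk k) := fun k => (hρ.contDiff_convolution (huk k)).continuous
  set Q : ℕ → (E × Metric.sphere (0 : E) 1) × ℝ → ℝ≥0∞ := fun k p =>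
    ENNReal.ofReal (B (p.2 * (((ρ ⋆ uk k) (p.1.1 + p.2 ^ (1 - s k)⁻¹ • (p.1.2 : E)) -
      (ρ ⋆ uk k) p.1.1) / p.2 ^ (1 - s k)⁻¹))) / ENNReal.ofReal p.2 with hQ
  have hQm : ∀ k, Measurable (Q k) := by
    intro k
    have h0 := (hcont k).measurable
    have h1 : Measurable fun p : (E × Metric.sphere (0 : E) 1) × ℝ =>
      p.2 * (((ρ ⋆ uk k) (p.1.1 + p.2 ^ (1 - s k)⁻¹ • (p.1.2 : E)) -
      (ρ ⋆ uk k) p.1.1) / p.2 ^ (1 - s k)⁻¹) := by fun_prop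
    exact ((hB.continuous.measurable.comp h1).ennreal_ofReal).div (by fun_prop)
  have hQm1 : ∀ k, Measurable fun p : E × Metric.sphere (0 : E) 1 =>
      ∫⁻ t in Ioo (0 : ℝ) 1, Q k (p, t) := fun k => (hQm k).lintegral_prod_right'
  have hQm2 : ∀ k, Measurable fun x : E => ∫⁻ w : Metric.sphere (0 : E) 1,
      (∫⁻ t in Ioo (0 : ℝ) 1, Q k ((x, w), t)) ∂volume.toSphere :=
    fun k => (hQm1 k).lintegral_prod_right'
  calc _ ≤ liminf (fun k => ∫⁻ x, ∫⁻ w : Metric.sphere (0 : E) 1,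
      (∫⁻ t in Ioo (0 : ℝ) 1, Q k ((x, w), t)) ∂volume.toSphere) atTop := by
        refine lintegral_le_liminf hQm2 (ae_of_all _ fun x => ?_)
        refine lintegral_le_liminf (fun k => (hQm1 k).comp
          (f := fun w : Metric.sphere (0 : E) 1 => (x, w)) (by fun_prop)) (ae_of_all _ fun w => ?_)
        refine lintegral_le_liminf (fun k => (hQm k).comp
          (f := fun t : ℝ => ((x, w), t)) (by fun_prop)) ?_
        filter_upwards [ae_restrict_mem measurableSet_Ioo] with t ht
        refine le_of_eq (Tendsto.liminf_eq ?_).symm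
        refine ENNReal.Tendsto.div_const ?_ (Or.inr (by simpa using ht.1))
        refine (ENNReal.continuous_ofReal.comp hB.continuous).continuousAt.tendsto.comp ?_
        refine Tendsto.const_mul t ?_
        have hfd : inner ℝ (w : E) (gradient (ρ ⋆ u) x) = fderiv ℝ (ρ ⋆ u) x w := by
          rw [real_inner_comm]; exact InnerProductSpace.toDual_symm_apply
        rw [hfd]
        refine tendsto_convolution_quotient hρ hu huk hconv
          (fun k => Real.rpow_pos_of_pos ht.1 _) ?_ x w
        have h1 : Tendsto (fun k => (1 - s k)⁻¹) atTop atTop := by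
          refine tendsto_inv_nhdsGT_zero.comp (tendsto_nhdsWithin_iff.2 ⟨?_, .of_forall fun k =>
            sub_pos.2 (hs k).2⟩)
          simpa using hs1.const_sub 1
        exact (tendsto_rpow_atTop_of_base_lt_one t (by linarith [ht.1]) ht.2).comp h1
    _ ≤ liminf (fun k => fracEnergy B (s k) (uk k)) atTop :=
        liminf_le_liminf (.of_forall fun k =>
          (lintegral_polar_le_fracEnergy hn hB (hs k) (hcont k).measurable).trans
            (fracEnergy_convolution_le hB (s k) hρ (huk k)))

end Polar

/-! ### From Luxemburg convergence to local L¹ convergence -/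

section Luxemburg

variable {n : ℕ}

local notation "E" => EuclideanSpace ℝ (Fin n)

theorem modular_abs (A : ℝ → ℝ) {k : ℝ} (hk : 0 < k) (u : E → ℝ) :
    modular (fun t => A |t|) k u = modular A k u := by
  simp [modular, _root_.abs_div, abs_of_pos hk]

theorem luxemburgNorm_abs (A : ℝ → ℝ) (u : E → ℝ) :
    luxemburgNorm (fun t => A |t|) u = luxemburgNorm A u := by
  unfold luxemburgNorm
  congr 1
  ext k
  exact and_congr_right fun hk => by rw [modular_abs A hk]

theorem MemEA.abs {A : ℝ → ℝ} {u : E → ℝ} (hu : MemEA A u) : MemEA (fun t => A |t|) u :=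
  ⟨hu.1, fun k hk => by rw [modular_abs A hk]; exact hu.2 k hk⟩

theorem fracEnergy_abs (A : ℝ → ℝ) (s : ℝ) (u : E → ℝ) :
    fracEnergy (fun t => A |t|) s u = fracEnergy A s u := by
  unfold fracEnergy
  congr 1
  refine lintegral_congr fun p => ?_
  beta_reduce
  rw [abs_of_nonneg (a := |u p.1 - u p.2| / ‖p.1 - p.2‖ ^ s) (by positivity)]

theorem sphericalAverage_abs (A : ℝ → ℝ) (e : E) (t : ℝ) :
    sphericalAverage (fun t => A |t|) e t = sphericalAverage A e t := by
  unfold sphericalAverage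
  refine setLIntegral_congr_fun measurableSet_Ioo fun r hr => ?_
  simp [abs_mul, abs_of_pos hr.1]

variable {B : ℝ → ℝ}

theorem IsEvenYoung.div_le (hB : IsEvenYoung B) (x : ℝ) {m : ℝ} (hm : 1 ≤ m) :
    B (x / m) ≤ m⁻¹ * B x := by
  have hm0 : 0 < m := by linarith
  have h := hB.convex.2 (mem_univ x) (mem_univ 0) (show 0 ≤ m⁻¹ by positivity)
    (sub_nonneg.2 (inv_le_one_of_one_le₀ hm)) (by ring)
  simpa [hB.zero, div_eq_inv_mul] using h

theorem IsEvenYoung.half_sub_le (hB : IsEvenYoung B) (x y : ℝ) :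
    B ((x - y) / 2) ≤ B x + B y := by
  have h := hB.convex.2 (mem_univ x) (mem_univ (-y)) (show (0 : ℝ) ≤ 1 / 2 by norm_num)
    (show (0 : ℝ) ≤ 1 / 2 by norm_num) (by norm_num)
  have h1 : B (-y) = B y := by rw [← hB.abs_eq (-y), abs_neg, hB.abs_eq]
  simp only [smul_eq_mul, h1] at h
  have h2 : (x - y) / 2 = 1 / 2 * x + 1 / 2 * -y := by ring
  rw [h2]
  linarith [hB.nonneg x, hB.nonneg y]

/-- Without an admissible k the infimum would take the default value 0 and smallness of the norm
would carry no information. -/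
theorem exists_modular_sub_le_one (hB : IsEvenYoung B) {u v : E → ℝ} (hu : MemEA B u)
    (hv : MemEA B v) : {k : ℝ | 0 < k ∧ modular B k (fun x => v x - u x) ≤ 1}.Nonempty := by
  set T := modular B 1 v + modular B 1 u
  have hTt : T ≠ ⊤ := ENNReal.add_ne_top.2 ⟨(hv.2 1 one_pos).ne, (hu.2 1 one_pos).ne⟩
  set m := T.toReal + 1
  have hm : 1 ≤ m := le_add_of_nonneg_left ENNReal.toReal_nonneg
  have hm0 : 0 < m := by linarith
  refine ⟨2 * m, by positivity, ?_⟩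
  have hpt : ∀ x, ENNReal.ofReal (B (|v x - u x| / (2 * m))) ≤ ENNReal.ofReal m⁻¹ *
      (ENNReal.ofReal (B (|v x| / 1)) + ENNReal.ofReal (B (|u x| / 1))) := by
    intro x
    rw [← ENNReal.ofReal_add (hB.nonneg _) (hB.nonneg _), ← ENNReal.ofReal_mul (by positivity)]
    apply ENNReal.ofReal_le_ofReal
    rw [hB.abs_div _ (by positivity), ← div_div, div_one, div_one, hB.abs_eq, hB.abs_eq]
    refine (hB.div_le _ hm).trans ?_
    gcongr
    exact hB.half_sub_le _ _
  have hmeas : AEMeasurable (fun x => ENNReal.ofReal (B (|v x| / 1))) := by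
    have h1 := (hv.1.aestronglyMeasurable.aemeasurable.abs).div_const 1
    exact (hB.continuous.measurable.comp_aemeasurable h1).ennreal_ofReal
  calc modular B (2 * m) (fun x => v x - u x) ≤ ENNReal.ofReal m⁻¹ * T := by
        refine (lintegral_mono hpt).trans_eq ?_
        rw [lintegral_const_mul' _ _ ENNReal.ofReal_ne_top, lintegral_add_left' hmeas]
        rfl
    _ ≤ ENNReal.ofReal m⁻¹ * ENNReal.ofReal m := by
        gcongr
        rw [← ENNReal.ofReal_toReal hTt]
        exact ENNReal.ofReal_le_ofReal (by simp [m])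
    _ = 1 := by
        rw [← ENNReal.ofReal_mul (by positivity), inv_mul_cancel₀ hm0.ne', ENNReal.ofReal_one]

/-- Superlinearity with K = 1 bounds |v| by κ(B(|v|/κ) + C); integrating over a ball costs a
constant times κ. -/
theorem tendsto_setLIntegral_of_luxemburgNorm (hB : IsEvenYoung B) {u : E → ℝ} (hu : MemEA B u)
    {uk : ℕ → E → ℝ} (huk : ∀ k, MemEA B (uk k))
    (hconv : Tendsto (fun k => luxemburgNorm B (fun x => uk k x - u x)) atTop (𝓝 0)) (R : ℝ) :
    Tendsto (fun k => ∫⁻ x in Metric.closedBall 0 R, ‖uk k x - u x‖ₑ) atTop (𝓝 0) := by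
  obtain ⟨C, hC0, hC⟩ := hB.superlinear 1 zero_le_one
  set D : ℝ≥0∞ := 1 + ENNReal.ofReal C * volume (Metric.closedBall (0 : E) R)
  have hD : D ≠ ⊤ := ENNReal.add_ne_top.2 ⟨ENNReal.one_ne_top,
    ENNReal.mul_ne_top ENNReal.ofReal_ne_top measure_closedBall_lt_top.ne⟩
  have hbound : ∀ k, ∀ κ : ℝ, 0 < κ → modular B κ (fun x => uk k x - u x) ≤ 1 →
      ∫⁻ x in Metric.closedBall 0 R, ‖uk k x - u x‖ₑ ≤ ENNReal.ofReal κ * D := by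
    intro k κ hκ hmod
    have hpt : ∀ x, ‖uk k x - u x‖ₑ ≤
        ENNReal.ofReal κ * (ENNReal.ofReal (B (|uk k x - u x| / κ)) + ENNReal.ofReal C) := by
      intro x
      rw [← ENNReal.ofReal_add (hB.nonneg _) hC0, ← ENNReal.ofReal_mul hκ.le, ← ofReal_norm,
        Real.norm_eq_abs]
      apply ENNReal.ofReal_le_ofReal
      have := hC (|uk k x - u x| / κ)
      rw [one_mul, abs_of_nonneg (by positivity), div_le_iff₀ hκ] at this
      linarith
    refine (lintegral_mono hpt).trans ?_
    rw [lintegral_const_mul' _ _ ENNReal.ofReal_ne_top, lintegral_add_right _ measurable_const,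
      setLIntegral_const]
    gcongr
    exact add_le_add ((setLIntegral_le_lintegral _ _).trans hmod) le_rfl
  have h0 : Tendsto (fun ε : ℝ => ENNReal.ofReal ε * D) (𝓝 0) (𝓝 0) := by
    have h1 : Tendsto (fun ε : ℝ => ENNReal.ofReal ε * D) (𝓝 0) (𝓝 (ENNReal.ofReal 0 * D)) :=
      ENNReal.Tendsto.mul_const (ENNReal.continuous_ofReal.tendsto 0) (Or.inr hD)
    simpa using h1
  -- The slack 1/(k+1) provides an admissible κ just above the infimum, with no claim that it is
  -- attained.
  have hlim : Tendsto (fun k : ℕ => luxemburgNorm B (fun x => uk k x - u x) + 1 / ((k : ℝ) + 1))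
      atTop (𝓝 0) := by
    simpa only [add_zero] using hconv.add tendsto_one_div_add_atTop_nhds_zero_nat
  refine tendsto_of_tendsto_of_tendsto_of_le_of_le tendsto_const_nhds (h0.comp hlim)
    (fun _ => bot_le) fun k => ?_
  obtain ⟨κ, ⟨hκ0, hκ⟩, hlt⟩ := exists_lt_of_csInf_lt (exists_modular_sub_le_one hB hu (huk k))
    (show sInf _ < luxemburgNorm B (fun x => uk k x - u x) + 1 / ((k : ℝ) + 1) from
      lt_add_of_pos_right _ (by positivity))
  refine (hbound k κ hκ0 hκ).trans ?_
  simp only [Function.comp_apply]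
  gcongr

end Luxemburg

/-! ### Construction of the weak gradient -/

section Limit

open scoped Convolution

variable {n : ℕ}

local notation "E" => EuclideanSpace ℝ (Fin n)

/-- A finite measure with positive density that is comparable to Lebesgue measure on balls. -/
noncomputable def weighted (n : ℕ) : Measure (EuclideanSpace ℝ (Fin n)) :=
  volume.withDensity fun x => ENNReal.ofReal ((1 + ‖x‖) ^ (-((n : ℝ) + 1)))

instance isFiniteMeasure_weighted : IsFiniteMeasure (weighted n) := by
  refine isFiniteMeasure_withDensity_ofReal (Integrable.hasFiniteIntegral ?_)
  exact integrable_one_add_norm (by simp)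

theorem weighted_le : weighted n ≤ volume := by
  conv_rhs => rw [← withDensity_one (μ := (volume : Measure E))]
  refine withDensity_mono (ae_of_all _ fun x => ?_)
  simp only [Pi.one_apply, ENNReal.ofReal_le_one]
  exact Real.rpow_le_one_of_one_le_of_nonpos (by simp) (by linarith [Nat.cast_nonneg (α := ℝ) n])

theorem absolutelyContinuous_weighted : (volume : Measure E) ≪ weighted n := by
  refine withDensity_absolutelyContinuous' (by fun_prop) (ae_of_all _ fun x => ?_)
  have : 0 < (1 + ‖x‖) ^ (-((n : ℝ) + 1)) := Real.rpow_pos_of_pos (by positivity) _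
  simpa using this

theorem exists_restrict_closedBall_le (R : ℝ) : ∃ C : ℝ≥0∞, C ≠ ⊤ ∧
    (volume : Measure E).restrict (Metric.closedBall 0 R) ≤ C • weighted n := by
  set R' := max R 0
  set c := ENNReal.ofReal ((1 + R') ^ (-((n : ℝ) + 1)))
  have hR' : 0 ≤ R' := le_max_right _ _
  have hc : c ≠ 0 := by
    have : 0 < (1 + R') ^ (-((n : ℝ) + 1)) := Real.rpow_pos_of_pos (by positivity) _
    simpa [c] using this
  refine ⟨c⁻¹, ENNReal.inv_ne_top.2 hc, ?_⟩
  have h1 : c • (volume : Measure E).restrict (Metric.closedBall 0 R) ≤ weighted n := by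
    rw [← withDensity_const, ← withDensity_indicator Metric.isClosed_closedBall.measurableSet]
    refine withDensity_mono (ae_of_all _ fun x => ?_)
    by_cases hx : x ∈ Metric.closedBall (0 : E) R
    swap
    · simp [indicator_of_notMem hx]
    rw [indicator_of_mem hx]
    apply ENNReal.ofReal_le_ofReal
    refine Real.rpow_le_rpow_of_nonpos (by positivity) ?_
      (by linarith [Nat.cast_nonneg (α := ℝ) n])
    have := (mem_closedBall_zero_iff.1 hx).trans (le_max_left R 0)
    linarith
  calc _ = c⁻¹ • c • (volume : Measure E).restrict (Metric.closedBall 0 R) := by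
        rw [smul_smul, ENNReal.inv_mul_cancel hc ENNReal.ofReal_ne_top, one_smul]
    _ ≤ _ := by gcongr

theorem locallyIntegrable_of_weighted {g : E → E} (hg : Integrable g (weighted n)) :
    LocallyIntegrable g := by
  rw [locallyIntegrable_iff]
  intro K hK
  obtain ⟨R, hR⟩ := hK.isBounded.subset_closedBall 0
  obtain ⟨C, hC, hle⟩ := exists_restrict_closedBall_le (n := n) R
  exact IntegrableOn.mono_set ((hg.smul_measure hC).mono_measure hle) hR

theorem tendsto_setLIntegral_of_weighted {h : ℕ → E → E} {g : E → E}
    (hlim : Tendsto (fun j => ∫⁻ x, ‖h j x - g x‖ₑ ∂weighted n) atTop (𝓝 0)) (R : ℝ) :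
    Tendsto (fun j => ∫⁻ x in Metric.closedBall 0 R, ‖h j x - g x‖ₑ) atTop (𝓝 0) := by
  obtain ⟨C, hC, hle⟩ := exists_restrict_closedBall_le (n := n) R
  have h1 : Tendsto (fun j => C * ∫⁻ x, ‖h j x - g x‖ₑ ∂weighted n) atTop (𝓝 0) := by
    simpa using ENNReal.Tendsto.const_mul hlim (Or.inr hC)
  refine tendsto_of_tendsto_of_tendsto_of_le_of_le tendsto_const_nhds h1 (fun _ => bot_le)
    fun j => ?_
  refine (lintegral_mono' hle le_rfl).trans_eq ?_
  rw [lintegral_smul_measure, smul_eq_mul]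

theorem tendsto_integral_mul_of_setLIntegral {h : ℕ → E → E} {g : E → E}
    (hh : ∀ j, LocallyIntegrable (h j)) (hg : LocallyIntegrable g)
    (hlim : ∀ R : ℝ, Tendsto (fun j => ∫⁻ x in Metric.closedBall 0 R, ‖h j x - g x‖ₑ)
      atTop (𝓝 0)) {φ : E → ℝ} (hφ : Continuous φ) (hφc : HasCompactSupport φ) (i : Fin n) :
    Tendsto (fun j => ∫ x, h j x i * φ x) atTop (𝓝 (∫ x, g x i * φ x)) := by
  obtain ⟨R, hR⟩ := hφc.isCompact.isBounded.subset_closedBall 0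
  obtain ⟨M, hM⟩ := hφc.exists_bound_of_continuous hφ
  have hint : ∀ f : E → E, LocallyIntegrable f → Integrable fun x => f x i * φ x := by
    intro f hf
    have h1 : LocallyIntegrable fun x => f x i := by
      rw [locallyIntegrable_iff] at hf ⊢
      exact fun K hK => (EuclideanSpace.proj (𝕜 := ℝ) i).integrable_comp (hf K hK)
    simpa [mul_comm] using h1.integrable_smul_left_of_hasCompactSupport hφ hφc
  refine tendsto_integral_of_L1 _ (hint g hg).1 (.of_forall fun j => hint _ (hh j)) ?_
  have h1 : Tendsto (fun j => ENNReal.ofReal M * ∫⁻ x in Metric.closedBall 0 R, ‖h j x - g x‖ₑ)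
      atTop (𝓝 0) := by
    simpa using ENNReal.Tendsto.const_mul (hlim R) (Or.inr ENNReal.ofReal_ne_top)
  refine tendsto_of_tendsto_of_tendsto_of_le_of_le tendsto_const_nhds h1 (fun _ => bot_le)
    fun j => ?_
  rw [← lintegral_const_mul' _ _ ENNReal.ofReal_ne_top,
    ← lintegral_indicator Metric.isClosed_closedBall.measurableSet]
  refine lintegral_mono fun x => ?_
  by_cases hx : x ∈ Metric.closedBall (0 : E) R
  · rw [indicator_of_mem hx, ← sub_mul, enorm_mul, mul_comm]
    gcongr
    · rw [← ofReal_norm]; exact ENNReal.ofReal_le_ofReal (hM x)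
    · rw [← ofReal_norm, ← ofReal_norm]
      apply ENNReal.ofReal_le_ofReal
      simpa using PiLp.norm_apply_le (h j x - g x) i
  · have : φ x = 0 := by
      by_contra h
      exact hx (hR (subset_tsupport φ h))
    simp [this]

/-- The pairing with ψ is the value at 0 of a convolution with the reflection of ψ. Associativity
moves the kernel onto the continuous function u ⋆ k, where approximate identities converge
pointwise. -/
theorem tendsto_integral_convolution_mul {u : E → ℝ} (hu : LocallyIntegrable u)
    {ρ : ℕ → E → ℝ} {δ : ℕ → ℝ} (hρ : ∀ j, IsKernel (δ j) (ρ j)) (hδ : Tendsto δ atTop (𝓝 0))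
    {ψ : E → ℝ} (hψ : Continuous ψ) (hψc : HasCompactSupport ψ) :
    Tendsto (fun j => ∫ x, (ρ j ⋆ u) x * ψ x) atTop (𝓝 (∫ x, u x * ψ x)) := by
  set k : E → ℝ := fun x => ψ (-x) with hk
  have hkc : Continuous k := by fun_prop
  have hks : HasCompactSupport k := hψc.comp_homeomorph (Homeomorph.neg E)
  have hzero : ∀ f : E → ℝ, ∫ x, f x * ψ x = (f ⋆ k) 0 := by
    intro f
    rw [convolution_lsmul]
    simp [hk]
  have hcont : Continuous (u ⋆ k) := hks.continuous_convolution_right _ hu hkc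
  have hun : LocallyIntegrable fun x => ‖u x‖ :=
    locallyIntegrable_iff.2 fun K hK => (locallyIntegrable_iff.1 hu K hK).norm
  have hassoc : ∀ j, ((ρ j ⋆ u) ⋆ k) 0 = (ρ j ⋆ (u ⋆ k)) 0 := by
    intro j
    refine convolution_assoc _ _ _ _ (fun x y z => by simp [mul_assoc])
      (hρ j).continuous.aestronglyMeasurable hu.aestronglyMeasurable hkc.aestronglyMeasurable
      (ae_of_all _ fun y => (hρ j).convolutionExists hu y)
      (ae_of_all _ fun y => hks.norm.convolutionExists_right _ hun hkc.norm y) ?_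
    exact (hρ j).hasCompactSupport.norm.convolutionExists_left _ (hρ j).continuous.norm
      (hks.norm.continuous_convolution_right _ hun hkc.norm).locallyIntegrable 0
  simp_rw [hzero, hassoc]
  refine convolution_tendsto_right (.of_forall fun j => (hρ j).nonneg)
    (.of_forall fun j => (hρ j).integral_eq_one) ?_
    (.of_forall fun _ => hcont.aestronglyMeasurable) ?_ tendsto_const_nhds
  · rw [tendsto_smallSets_iff]
    intro t ht
    obtain ⟨ε, hε, hεt⟩ := Metric.mem_nhds_iff.1 ht
    filter_upwards [hδ.eventually_lt_const hε] with j hj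
    exact (hρ j).support_subset.trans ((Metric.ball_subset_ball hj.le).trans hεt)
  · exact hcont.continuousAt.tendsto.comp tendsto_snd

theorem integral_mul_fderiv_eq_neg_gradient {v : E → ℝ} (hv : ContDiff ℝ 1 v) {φ : E → ℝ}
    (hφ : ContDiff ℝ (⊤ : ℕ∞) φ) (hφc : HasCompactSupport φ) (i : Fin n) :
    ∫ x, v x * fderiv ℝ φ x (EuclideanSpace.single i 1) = -∫ x, gradient v x i * φ x := by
  have hφ1 : Continuous fun x => fderiv ℝ φ x (EuclideanSpace.single i 1) :=
    (hφ.continuous_fderiv (by simp)).clm_apply continuous_const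
  have hv1 : Continuous fun x => fderiv ℝ v x (EuclideanSpace.single i 1) :=
    (hv.continuous_fderiv (by simp)).clm_apply continuous_const
  have hφ1c : HasCompactSupport fun x => fderiv ℝ φ x (EuclideanSpace.single i 1) :=
    hφc.fderiv_apply (𝕜 := ℝ) _
  rw [integral_mul_fderiv_eq_neg_fderiv_mul_of_integrable]
  · congr 1
    refine integral_congr_ae (ae_of_all _ fun x => ?_)
    have h : inner ℝ (gradient v x) (EuclideanSpace.single i (1 : ℝ)) =
        fderiv ℝ v x (EuclideanSpace.single i 1) := InnerProductSpace.toDual_symm_apply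
    simp only [← h, EuclideanSpace.inner_single_right]
    simp
  · exact (hv1.mul hφ.continuous).integrable_of_hasCompactSupport hφc.mul_left
  · exact (hv.continuous.mul hφ1).integrable_of_hasCompactSupport hφ1c.mul_left
  · exact (hv.continuous.mul hφ.continuous).integrable_of_hasCompactSupport hφc.mul_left
  · exact fun x _ => hv.differentiable (by simp) x
  · exact fun x _ => hφ.differentiable (by simp) x

theorem continuous_gradient {v : E → ℝ} (hv : ContDiff ℝ 1 v) : Continuous (gradient v) :=
  (InnerProductSpace.toDual ℝ E).symm.continuous.comp (hv.continuous_fderiv (by simp))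

theorem IsKernel.contDiff_convolution_one {δ : ℝ} {ρ u : E → ℝ} (hρ : IsKernel δ ρ)
    (hu : LocallyIntegrable u) : ContDiff ℝ 1 (ρ ⋆ u) :=
  (hρ.contDiff_convolution hu).of_le (by exact_mod_cast le_top)

theorem gradient_convolution_midpoint {δ : ℝ} {ρ ρ' u : E → ℝ} (hρ : IsKernel δ ρ)
    (hρ' : IsKernel δ ρ') (hu : LocallyIntegrable u) :
    gradient (((1 / 2 : ℝ) • (ρ + ρ')) ⋆ u) =
      fun x => (1 / 2 : ℝ) • (gradient (ρ ⋆ u) x + gradient (ρ' ⋆ u) x) := by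
  have hd := (hρ.contDiff_convolution_one hu).differentiable (by simp)
  have hd' := (hρ'.contDiff_convolution_one hu).differentiable (by simp)
  ext1 x
  rw [smul_convolution, (hρ.convolutionExists hu).add_distrib (hρ'.convolutionExists hu), gradient,
    fderiv_const_smul ((hd x).add (hd' x)), fderiv_add (hd x) (hd' x), map_smul, map_add]
  rfl

/-- The bound holds for all kernels, so the compactness argument may choose them; their radii still
tend to 0, hence ρ_j ⋆ u → u against test functions. -/
theorem exists_isWeakGradient {B : ℝ → ℝ} (hB : IsEvenYoung B) {e : E} (he : ‖e‖ = 1)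
    {u : E → ℝ} (hu : LocallyIntegrable u) {L : ℝ≥0∞} (hL : L ≠ ⊤)
    (hbd : ∀ (δ : ℝ) (ρ : E → ℝ), IsKernel δ ρ → ∫⁻ x, gradDensity B (gradient (ρ ⋆ u) x) ≤ L) :
    ∃ g, IsWeakGradient u g ∧ ∫⁻ x, gradDensity B (g x) ≤ L := by
  set δ : ℕ → ℝ := fun j => 1 / ((j : ℝ) + 1) with hδ
  have hδ0 : Tendsto δ atTop (𝓝 0) := tendsto_one_div_add_atTop_nhds_zero_nat
  set S : ℕ → Set (E → E) := fun j => {h | ∃ ρ, IsKernel (δ j) ρ ∧ h = gradient (ρ ⋆ u)} with hS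
  have hcont : ∀ (δ : ℝ) (ρ : E → ℝ), IsKernel δ ρ → Continuous (gradient (ρ ⋆ u)) :=
    fun δ ρ hρ => continuous_gradient (hρ.contDiff_convolution_one hu)
  obtain ⟨h, hhS, g, hg, hlim⟩ := exists_seq_tendsto_of_midpoint (ν := weighted n)
    (Ψ := gradDensity B) (fun K hK => gradDensity_superlinear hB he hK) (S := S)
    (fun i j hij => by
      rintro _ ⟨ρ, hρ, rfl⟩
      exact ⟨ρ, hρ.mono (by simp only [hδ]; gcongr), rfl⟩)
    (fun j => by
      obtain ⟨ρ, hρ⟩ := IsKernel.exists_of_pos (n := n) (δ := δ j) (by simp only [hδ]; positivity)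
      exact ⟨_, ρ, hρ, rfl⟩)
    (fun j => by
      rintro _ ⟨ρ, hρ, rfl⟩ _ ⟨ρ', hρ', rfl⟩
      exact ⟨_, hρ.midpoint hρ', (gradient_convolution_midpoint hρ hρ' hu).symm⟩)
    (by
      rintro _ ⟨ρ, hρ, rfl⟩
      exact (hcont _ ρ hρ).aestronglyMeasurable)
    hL
    (by
      rintro _ ⟨ρ, hρ, rfl⟩
      exact (lintegral_mono' weighted_le le_rfl).trans (hbd _ ρ hρ))
    (by
      rintro _ ⟨ρ, hρ, rfl⟩
      exact ((measurable_gradDensity hB).comp (hcont _ ρ hρ).measurable).aemeasurable)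
  choose ρ hρ hh using hhS
  have hhc : ∀ j, Continuous (h j) := fun j => by rw [hh j]; exact hcont _ _ (hρ j)
  have hgl := locallyIntegrable_of_weighted hg
  refine ⟨g, ⟨hu, hgl, fun φ hφ hφc i => ?_⟩, ?_⟩
  · have hφ1 : Continuous fun x => fderiv ℝ φ x (EuclideanSpace.single i 1) :=
      (hφ.continuous_fderiv (by simp)).clm_apply continuous_const
    have h1 := tendsto_integral_convolution_mul hu hρ hδ0 hφ1 (hφc.fderiv_apply (𝕜 := ℝ) _)
    have h2 := (tendsto_integral_mul_of_setLIntegral (fun j => (hhc j).locallyIntegrable) hgl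
      (tendsto_setLIntegral_of_weighted hlim) hφ.continuous hφc i).neg
    refine tendsto_nhds_unique h1 (h2.congr fun j => ?_)
    rw [hh j, integral_mul_fderiv_eq_neg_gradient ((hρ j).contDiff_convolution_one hu) hφ hφc]
  -- L¹ convergence gives an a.e. convergent subsequence for the weighted measure, hence for
  -- Lebesgue measure, since the weight is positive.
  · have hmeas : TendstoInMeasure (weighted n) h atTop g := by
      refine tendstoInMeasure_of_tendsto_eLpNorm one_ne_zero
        (fun j => (hhc j).aestronglyMeasurable) hg.1 ?_
      simpa only [eLpNorm_one_eq_lintegral_enorm, Pi.sub_apply] using hlim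
    obtain ⟨ns, -, hns⟩ := hmeas.exists_seq_tendsto_ae
    have hΨ := measurable_gradDensity (n := n) hB
    calc ∫⁻ x, gradDensity B (g x) ≤
        liminf (fun k => ∫⁻ x, gradDensity B (h (ns k) x)) atTop := by
          refine lintegral_le_liminf (fun k => hΨ.comp (hhc _).measurable) ?_
          filter_upwards [absolutelyContinuous_weighted.ae_le hns] with x hx
          exact gradDensity_le_liminf hB hx
      _ ≤ liminf (fun _ : ℕ => L) atTop := by
          refine liminf_le_liminf (.of_forall fun k => ?_)
          rw [hh]
          exact hbd _ _ (hρ _)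
      _ = L := liminf_const L

end Limit

end FracOrlicz

theorem mainTheorem1 {n : ℕ} (hn : 1 ≤ n)
    (A : ℝ → ℝ) (hA : FracOrlicz.IsYoungFunction A)
    (e : EuclideanSpace ℝ (Fin n)) (he : ‖e‖ = 1)
    (u : EuclideanSpace ℝ (Fin n) → ℝ) (hu : FracOrlicz.MemEA A u)
    (uk : ℕ → EuclideanSpace ℝ (Fin n) → ℝ) (huk : ∀ k, FracOrlicz.MemEA A (uk k))
    (hconv : Tendsto (fun k => FracOrlicz.luxemburgNorm A (fun x => uk k x - u x)) atTop (𝓝 0))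
    (s : ℕ → ℝ) (hs : ∀ k, s k ∈ Ioo (0 : ℝ) 1) (hs1 : Tendsto s atTop (𝓝 1)) :
    FracOrlicz.limitEnergy A e u ≤
      liminf (fun k => FracOrlicz.fracEnergy A (s k) (uk k)) atTop := by
  have hB := hA.isEvenYoung
  simp_rw [← FracOrlicz.fracEnergy_abs A]
  simp_rw [← FracOrlicz.luxemburgNorm_abs A] at hconv
  set B : ℝ → ℝ := fun t => A |t|
  set L := liminf (fun k => FracOrlicz.fracEnergy B (s k) (uk k)) atTop
  by_cases hL : L = ⊤
  · simp [hL]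
  have hloc := FracOrlicz.tendsto_setLIntegral_of_luxemburgNorm hB hu.abs (fun k => (huk k).abs)
    hconv
  obtain ⟨g, hg, hgL⟩ := FracOrlicz.exists_isWeakGradient hB he hu.1 hL fun δ ρ hρ =>
    FracOrlicz.lintegral_gradDensity_le_liminf hn hB hρ hu.1 (fun k => (huk k).1) hloc hs hs1
  -- The infimum is bounded by its value at the constructed g, so uniqueness of weak gradients plays
  -- no role.
  refine (iInf₂_le g hg).trans (le_trans (le_of_eq (lintegral_congr fun x => ?_)) hgL)
  rw [← FracOrlicz.sphericalAverage_abs, FracOrlicz.sphericalAverage_eq_gradDensity hB he]
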